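/- Let $a,b>0$ and let $\gamma,\widetilde\gamma\in\mathbb R$ with $\widetilde\gamma\neq\gamma$. Let $\Gamma_0$ be the infinite double-sided comb with internal vertices $x_j$ and boundary vertices $x_j^{\pm}$, $j\in\mathbb Z$, in which consecutive vertices $x_{j-1},x_j$ are joined by an edge $e_j$ of length $a$ and $x_j$ is joined to $x_j^{+}$ and to $x_j^{-}$ by edges $e_j^{+}$ and $e_j^{-}$ of length $b/2$; the edges are oriented from $x_{j-1}$ to $x_j$, from $x_j$ to $x_j^+$, and from $x_j^-$ to $x_j$. For $\theta\in[-\pi,\pi]$ let $\mathscr H^{\theta}_{\gamma,\widetilde\gamma}$ be the operator in $L^2(\Gamma_0)$ acting as $-\frac{\mathrm d^2}{\mathrm dx^2}$ on every edge, whose domain consists of all $\psi\in L^2(\Gamma_0)$ that belong to $H^2$ on each edge, with $\psi''\in L^2(\Gamma_0)$, and that satisfy, for every $j\in\mathbb Z$ and with $\psi_j,\psi_j^\pm$ the restrictions of $\psi$ to $e_j,e_j^\pm$, - $\psi_j(x_j)=\psi_{j+1}(x_j)=\psi_j^+(x_j)=\psi_j^-(x_j)=:\psi(x_j)$, - $-\psi_j'(x_j)+\psi_{j+1}'(x_j)-(\psi_j^-)'(x_j)+(\psi_j^+)'(x_j)=\gamma_j\,\psi(x_j)$,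 where $\gamma_0=\widetilde\gamma$ and $\gamma_j=\gamma$ for $j\ne0$, - $\psi_j^+(x_j^+)=\mathrm e^{i\theta}\psi_j^-(x_j^-)$ and $(\psi_j^+)'(x_j^+)=\mathrm e^{i\theta}(\psi_j^-)'(x_j^-)$. Put $$S_{\gamma,\widetilde\gamma}=\bigcup_{\theta\in[-\pi,\pi]}\sigma_{\rm disc}\bigl(\mathscr H^{\theta}_{\gamma,\widetilde\gamma}\bigr),$$ where the discrete spectrum $\sigma_{\rm disc}$ is the set of the eigenvalues of finite multiplicity that are isolated points of the spectrum. Then, whether $a/b$ is rational or irrational, $$\lim_{K\to\infty}\frac1K\,\bigl|S_{\gamma,\widetilde\gamma}\cap[0,K]\bigr|=\frac12,$$ where $|\cdot|$ denotes the Lebesgue measure on $\mathbb R$. -/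

import Mathlib

open MeasureTheory

noncomputable section

namespace CombGraph

/-! ### Spectral notions for unbounded operators on a complex normed space -/

section Spectral

variable {H : Type*} [NormedAddCommGroup H] [NormedSpace ℂ H]

/-- The resolvent set of an unbounded operator `A`: those `z` for which `A - z` is a bijection
from the domain of `A` onto the whole space with a bounded inverse `R`. -/
def resolventSet (A : H →ₗ.[ℂ] H) : Set ℂ :=
  {z | ∃ R : H →L[ℂ] H,
    (∀ y : H, ∃ h : R y ∈ A.domain, A ⟨R y, h⟩ - z • R y = y) ∧
    ∀ x : A.domain, R (A x - z • (x : H)) = x}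

/-- The spectrum of an unbounded operator. -/
def spec (A : H →ₗ.[ℂ] H) : Set ℂ := (resolventSet A)ᶜ

/-- The space of solutions `x` in the domain of `A` of the equation `A x = z x`. -/
def eigenspace (A : H →ₗ.[ℂ] H) (z : ℂ) : Submodule ℂ A.domain :=
  LinearMap.ker (A.toFun - z • A.domain.subtype)

/-- The (real) discrete spectrum: eigenvalues of finite multiplicity which are isolated points of
the spectrum. -/
def discreteSpectrum (A : H →ₗ.[ℂ] H) : Set ℝ :=
  {E | (E : ℂ) ∈ spec A ∧
    (∃ ε > 0, ∀ z ∈ spec A, ‖z - (E : ℂ)‖ < ε → z = (E : ℂ)) ∧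
    eigenspace A (E : ℂ) ≠ ⊥ ∧
    FiniteDimensional ℂ (eigenspace A (E : ℂ))}

end Spectral

/-! ### The double-sided comb -/

/-- The edges of the comb with internal vertices `x_j` and boundary vertices `x_j^±`, `j ∈ ℤ`:
`hor j` runs from `x_{j-1}` to `x_j`, `up j` from `x_j` to `x_j^+`, `down j` from `x_j^-`
to `x_j`. Each edge `e` is identified with `[0, len e]`, oriented as just described. -/
inductive Edge : Type
  | hor (j : ℤ)
  | up (j : ℤ)
  | down (j : ℤ)

/-- The edge lengths. -/
def len (a b : ℝ) : Edge → ℝ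
  | .hor _ => a
  | .up _ => b / 2
  | .down _ => b / 2

/-- The space `L²` of a single edge of length `ℓ`. -/
abbrev EdgeL2 (ℓ : ℝ) : Type := Lp ℂ 2 (volume.restrict (Set.Ioo 0 ℓ))

/-- The Hilbert space `L²` of the comb: the Hilbert sum of the spaces `L²` of its edges. -/
abbrev CombL2 (a b : ℝ) : Type := lp (fun e : Edge => EdgeL2 (len a b e)) 2

/-- `ψ` belongs to the Sobolev space `H²(0, ℓ)` and `g = -ψ''`: the class `ψ` has a representative
`u` which is continuously differentiable on `[0, ℓ]` with an absolutely continuous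
derivative `du`, whose derivative is `-g`. -/
structure IsNegSecondDeriv (ℓ : ℝ) (ψ g : EdgeL2 ℓ) (u du : ℝ → ℂ) : Prop where
  ae_eq : (ψ : ℝ → ℂ) =ᵐ[volume.restrict (Set.Ioo 0 ℓ)] u
  eq_integral : ∀ x ∈ Set.Icc 0 ℓ, u x = u 0 + ∫ t in (0 : ℝ)..x, du t
  deriv_eq_integral : ∀ x ∈ Set.Icc 0 ℓ, du x = du 0 - ∫ t in (0 : ℝ)..x, (g : ℝ → ℂ) t

/-- The strength of the `δ`-coupling at the vertex `x_j`. -/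
def coupling (γ γ' : ℝ) (j : ℤ) : ℝ := if j = 0 then γ' else γ

/-- The vertex conditions for functions `u e` with derivatives `du e` on the edges:
continuity and the `δ`-condition at each internal vertex `x_j`, quasi-periodicity
with quasimomentum `θ` at the pair of boundary vertices `x_j^±`. -/
structure VertexConditions (a b γ γ' θ : ℝ) (u du : Edge → ℝ → ℂ) : Prop where
  cont_right : ∀ j, u (.hor (j + 1)) 0 = u (.hor j) a
  cont_up : ∀ j, u (.up j) 0 = u (.hor j) a
  cont_down : ∀ j, u (.down j) (b / 2) = u (.hor j) a
  delta : ∀ j, -du (.hor j) a + du (.hor (j + 1)) 0 - du (.down j) (b / 2) + du (.up j) 0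
    = (coupling γ γ' j : ℂ) * u (.hor j) a
  quasi : ∀ j, u (.up j) (b / 2) = Complex.exp (θ * Complex.I) * u (.down j) 0
  quasi_deriv : ∀ j, du (.up j) (b / 2) = Complex.exp (θ * Complex.I) * du (.down j) 0

theorem EdgeL2.intervalIntegrable {ℓ : ℝ} (g : EdgeL2 ℓ) {x : ℝ} (hx : x ∈ Set.Icc 0 ℓ) :
    IntervalIntegrable (g : ℝ → ℂ) volume 0 x := by
  have h1 : Integrable (g : ℝ → ℂ) (volume.restrict (Set.Ioo 0 ℓ)) :=
    (Lp.memLp g).integrable (by norm_num)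
  have h2 : IntegrableOn (g : ℝ → ℂ) (Set.Ioc 0 ℓ) := by
    rw [integrableOn_Ioc_iff_integrableOn_Ioo]; exact h1
  rw [intervalIntegrable_iff_integrableOn_Ioc_of_le hx.1]
  exact h2.mono_set (Set.Ioc_subset_Ioc_right hx.2)

theorem IsNegSecondDeriv.continuousOn_deriv {ℓ : ℝ} {ψ g : EdgeL2 ℓ} {u du : ℝ → ℂ}
    (h : IsNegSecondDeriv ℓ ψ g u du) : ContinuousOn du (Set.Icc 0 ℓ) := by
  by_cases hℓ : 0 ≤ ℓ
  · have hI := g.intervalIntegrable (x := ℓ) ⟨hℓ, le_rfl⟩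
    have hc : ContinuousOn (fun x => du 0 - ∫ t in (0 : ℝ)..x, (g : ℝ → ℂ) t) (Set.Icc 0 ℓ) := by
      have := intervalIntegral.continuousOn_primitive_interval' hI Set.left_mem_uIcc
      rw [Set.uIcc_of_le hℓ] at this
      exact continuousOn_const.sub this
    exact hc.congr h.deriv_eq_integral
  · rw [Set.Icc_eq_empty hℓ]; exact continuousOn_empty _

theorem IsNegSecondDeriv.intervalIntegrable_deriv {ℓ : ℝ} {ψ g : EdgeL2 ℓ} {u du : ℝ → ℂ}
    (h : IsNegSecondDeriv ℓ ψ g u du) {x : ℝ} (hx : x ∈ Set.Icc 0 ℓ) :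
    IntervalIntegrable du volume 0 x := by
  apply ContinuousOn.intervalIntegrable
  rw [Set.uIcc_of_le hx.1]
  exact h.continuousOn_deriv.mono (Set.Icc_subset_Icc_right hx.2)

theorem IsNegSecondDeriv.zero (ℓ : ℝ) :
    IsNegSecondDeriv ℓ 0 0 (fun _ => 0) (fun _ => 0) where
  ae_eq := Lp.coeFn_zero _ _ _
  eq_integral x _ := by simp
  deriv_eq_integral x hx := by
    have h0 : ∫ t in (0 : ℝ)..x, ((0 : EdgeL2 ℓ) : ℝ → ℂ) t = 0 := by
      rw [intervalIntegral.integral_of_le hx.1, ← integral_Icc_eq_integral_Ioc,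
        integral_Icc_eq_integral_Ioo]
      have : ((0 : EdgeL2 ℓ) : ℝ → ℂ) =ᵐ[volume.restrict (Set.Ioo 0 x)] 0 :=
        ae_restrict_of_ae_restrict_of_subset (Set.Ioo_subset_Ioo_right hx.2)
          (Lp.coeFn_zero ℂ 2 (volume.restrict (Set.Ioo 0 ℓ)))
      rw [integral_congr_ae this]; simp
    rw [h0, sub_zero]

theorem intervalIntegral_congr_edge {ℓ x : ℝ} (hx : x ∈ Set.Icc 0 ℓ) {f g : ℝ → ℂ}
    (h : f =ᵐ[volume.restrict (Set.Ioo 0 ℓ)] g) :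
    ∫ t in (0 : ℝ)..x, f t = ∫ t in (0 : ℝ)..x, g t := by
  rw [intervalIntegral.integral_of_le hx.1, intervalIntegral.integral_of_le hx.1,
    ← integral_Icc_eq_integral_Ioc, ← integral_Icc_eq_integral_Ioc,
    integral_Icc_eq_integral_Ioo, integral_Icc_eq_integral_Ioo]
  exact integral_congr_ae
    (ae_restrict_of_ae_restrict_of_subset (Set.Ioo_subset_Ioo_right hx.2) h)

theorem IsNegSecondDeriv.add {ℓ : ℝ} {ψ₁ g₁ ψ₂ g₂ : EdgeL2 ℓ} {u₁ du₁ u₂ du₂ : ℝ → ℂ}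
    (h₁ : IsNegSecondDeriv ℓ ψ₁ g₁ u₁ du₁) (h₂ : IsNegSecondDeriv ℓ ψ₂ g₂ u₂ du₂) :
    IsNegSecondDeriv ℓ (ψ₁ + ψ₂) (g₁ + g₂) (u₁ + u₂) (du₁ + du₂) where
  ae_eq := (Lp.coeFn_add _ _).trans (h₁.ae_eq.add h₂.ae_eq)
  eq_integral x hx := by
    simp only [Pi.add_apply]
    rw [intervalIntegral.integral_add (h₁.intervalIntegrable_deriv hx)
      (h₂.intervalIntegrable_deriv hx), h₁.eq_integral x hx, h₂.eq_integral x hx]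
    ring
  deriv_eq_integral x hx := by
    rw [intervalIntegral_congr_edge hx (Lp.coeFn_add g₁ g₂)]
    simp only [Pi.add_apply]
    rw [intervalIntegral.integral_add (g₁.intervalIntegrable hx) (g₂.intervalIntegrable hx),
      h₁.deriv_eq_integral x hx, h₂.deriv_eq_integral x hx]
    ring

theorem IsNegSecondDeriv.smul {ℓ : ℝ} (c : ℂ) {ψ g : EdgeL2 ℓ} {u du : ℝ → ℂ}
    (h : IsNegSecondDeriv ℓ ψ g u du) :
    IsNegSecondDeriv ℓ (c • ψ) (c • g) (c • u) (c • du) where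
  ae_eq := (Lp.coeFn_smul c ψ).trans (h.ae_eq.const_smul c)
  eq_integral x hx := by
    simp only [Pi.smul_apply]
    rw [intervalIntegral.integral_smul, h.eq_integral x hx, smul_add]
  deriv_eq_integral x hx := by
    rw [intervalIntegral_congr_edge hx (Lp.coeFn_smul c g)]
    simp only [Pi.smul_apply]
    rw [intervalIntegral.integral_smul, h.deriv_eq_integral x hx, smul_sub]

/-- The graph of the fiber operator: all pairs `(ψ, g)` in the Hilbert space such that `ψ` is `H²`
on every edge, satisfies the vertex conditions, and `g = -ψ''` on every edge. -/
def fiberGraph (a b γ γ' θ : ℝ) : Submodule ℂ (CombL2 a b × CombL2 a b) where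
  carrier := {p | ∃ u du : Edge → ℝ → ℂ,
    (∀ e, IsNegSecondDeriv (len a b e) (p.1 e) (p.2 e) (u e) (du e)) ∧
    VertexConditions a b γ γ' θ u du}
  zero_mem' := ⟨fun _ _ => 0, fun _ _ => 0, fun _ => IsNegSecondDeriv.zero _,
    by constructor <;> simp⟩
  add_mem' := by
    rintro p q ⟨u₁, du₁, h₁, v₁⟩ ⟨u₂, du₂, h₂, v₂⟩
    refine ⟨u₁ + u₂, du₁ + du₂, fun e => (h₁ e).add (h₂ e), ?_⟩
    constructor <;> intro j <;> simp only [Pi.add_apply]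
    · rw [v₁.cont_right, v₂.cont_right]
    · rw [v₁.cont_up, v₂.cont_up]
    · rw [v₁.cont_down, v₂.cont_down]
    · linear_combination v₁.delta j + v₂.delta j
    · linear_combination v₁.quasi j + v₂.quasi j
    · linear_combination v₁.quasi_deriv j + v₂.quasi_deriv j
  smul_mem' := by
    rintro c p ⟨u, du, h, v⟩
    refine ⟨c • u, c • du, fun e => (h e).smul c, ?_⟩
    constructor <;> intro j <;> simp only [Pi.smul_apply, smul_eq_mul]
    · rw [v.cont_right]
    · rw [v.cont_up]
    · rw [v.cont_down]
    · linear_combination c * v.delta j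
    · linear_combination c * v.quasi j
    · linear_combination c * v.quasi_deriv j

theorem ae_eq_zero_of_primitive_eq_zero {ℓ : ℝ} (hℓ : 0 < ℓ) {w : ℝ → ℂ} (c : ℂ)
    (hw : IntervalIntegrable w volume 0 ℓ)
    (h : ∀ x ∈ Set.Ioo 0 ℓ, c + ∫ t in (0 : ℝ)..x, w t = 0) :
    w =ᵐ[volume.restrict (Set.Ioo 0 ℓ)] 0 := by
  rw [Filter.EventuallyEq, ae_restrict_iff' measurableSet_Ioo]
  filter_upwards [hw.ae_hasDerivAt_integral] with x hx hxI
  have h1 := hx (by rw [Set.uIcc_of_le hℓ.le]; exact Set.Ioo_subset_Icc_self hxI) 0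
    Set.left_mem_uIcc
  have h2 : HasDerivAt (fun x => ∫ t in (0 : ℝ)..x, w t) 0 x := by
    refine (hasDerivAt_const x (-c)).congr_of_eventuallyEq ?_
    filter_upwards [isOpen_Ioo.mem_nhds hxI] with y hy
    linear_combination h y hy
  exact h1.unique h2

theorem IsNegSecondDeriv.eq_zero {ℓ : ℝ} {g : EdgeL2 ℓ} {u du : ℝ → ℂ}
    (h : IsNegSecondDeriv ℓ 0 g u du) : g = 0 := by
  rw [Lp.eq_zero_iff_ae_eq_zero]
  by_cases hℓ : 0 < ℓ
  swap
  · rw [Filter.EventuallyEq, ae_restrict_iff' measurableSet_Ioo]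
    exact Filter.Eventually.of_forall fun x hx => absurd (hx.1.trans hx.2) hℓ
  have hm : ℓ ∈ Set.Icc 0 ℓ := ⟨hℓ.le, le_rfl⟩
  have hu : ContinuousOn u (Set.Ioo 0 ℓ) := by
    have hc := intervalIntegral.continuousOn_primitive_interval'
      (h.intervalIntegrable_deriv hm) Set.left_mem_uIcc
    rw [Set.uIcc_of_le hℓ.le] at hc
    exact ((continuousOn_const.add hc).congr h.eq_integral).mono Set.Ioo_subset_Icc_self
  have hu0 : Set.EqOn u 0 (Set.Ioo 0 ℓ) :=
    Measure.eqOn_Ioo_of_ae_eq volume (h.ae_eq.symm.trans (Lp.coeFn_zero _ _ _)) hu continuousOn_const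
  have hdu0 : Set.EqOn du 0 (Set.Ioo 0 ℓ) :=
    Measure.eqOn_Ioo_of_ae_eq volume
      (ae_eq_zero_of_primitive_eq_zero hℓ (u 0) (h.intervalIntegrable_deriv hm) fun x hx => by
        rw [← h.eq_integral x (Set.Ioo_subset_Icc_self hx)]; exact hu0 hx)
      (h.continuousOn_deriv.mono Set.Ioo_subset_Icc_self) continuousOn_const
  refine ae_eq_zero_of_primitive_eq_zero hℓ (-du 0) (g.intervalIntegrable hm) fun x hx => ?_
  have h1 := h.deriv_eq_integral x (Set.Ioo_subset_Icc_self hx)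
  have h2 : du x = 0 := hdu0 hx
  linear_combination h1 - h2

/-- `fiberGraph` is the graph of an operator, i.e. it is single-valued. -/
theorem fiberGraph_single_valued (a b γ γ' θ : ℝ) (p : CombL2 a b × CombL2 a b)
    (hp : p ∈ fiberGraph a b γ γ' θ) (h0 : p.1 = 0) : p.2 = 0 := by
  obtain ⟨u, du, h, -⟩ := hp
  ext1
  funext e
  have he := h e
  rw [h0] at he
  exact IsNegSecondDeriv.eq_zero he

/-- The fiber operator on the comb: it acts as `-d²/dx²` on the edges, its domain consists of the
`H²`-functions satisfying the vertex conditions. -/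
def fiberOp (a b γ γ' θ : ℝ) : CombL2 a b →ₗ.[ℂ] CombL2 a b :=
  (fiberGraph a b γ γ' θ).toLinearPMap

theorem fiberOp_graph (a b γ γ' θ : ℝ) :
    (fiberOp a b γ γ' θ).graph = fiberGraph a b γ γ' θ :=
  Submodule.toLinearPMap_graph_eq _ (fiberGraph_single_valued a b γ γ' θ)

/-- The union over the quasimomentum of the discrete spectra of the fiber operators. -/
def inducedBands (a b γ γ' : ℝ) : Set ℝ :=
  ⋃ θ ∈ Set.Icc (-Real.pi) Real.pi, discreteSpectrum (fiberOp a b γ γ' θ)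

end CombGraph

end

open MeasureTheory

noncomputable section

namespace CombGraph

section

/-! ### Absolutely continuous functions -/

/-! Fix `k > 0` with `sin (k a)` and `sin (k b)` nonzero. A solution of `-ψ'' = k² ψ` obeying the
vertex conditions is determined by its vertex values `p j`, and eliminating the edges turns the
problem into a difference equation on the integers, `p (j+1) + p (j-1) - 2 F p j = s p 0` at `j = 0`
and `= 0` elsewhere (`vertex_recursion`). Here `F = disc` contains `θ`, and `s = defect = (γ' - γ)
sin (k a) / k`. Decaying solutions are multiples of `μ ^ |j|` with `μ + μ⁻¹ = 2 F` and `μ - μ⁻¹ =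
s`, so eigenvalues are characterised by `F² = 1 + s²/4` and `F s < 0`. Conversely such energies are
isolated simple eigenvalues: nearby the lattice operator is inverted explicitly and the resolvent is
assembled edge by edge (`mem_resolventSet`, `mem_discreteSpectrum`).

The dispersion relation is affine in `cos θ`. Solved for it, it reads `cos θ = bandFun k`, so off a
null set `k²` lies in the union over `θ` exactly when `|bandFun k| ≤ 1` (`mem_inducedBands_iff`). As
`k → ∞`, `bandFun` differs by `O(1/k)` from a limit `G` with `G² - 1 = 2 (cos ka + τ) sin kb sin
k(a+b) / sin² ka`, where `τ` is the sign of `(γ' - γ) sin ka`. Hence, asymptotically, `k` is in the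
bands if and only if `(γ' - γ) sin ka sin kb sin k(a+b) < 0`.

With `x = ka/π` and `y = kb/π`, the sign of the triple product is governed by the carry `{x} + {y} -
{x+y}`, which is 0 or 1 (`fract_carry`). The carry is a linear combination of three sawtooth
functions, each of mean 1/2, so its mean is 1/2 + 1/2 - 1/2 = 1/2, whatever the arithmetic nature of
`a/b`. The substitution `E = k²` makes these means weighted by `2k dk`. -/

theorem absolutelyContinuousOnInterval_primitive {E : Type*} [NormedAddCommGroup E]
    [NormedSpace ℝ E] {f : ℝ → E} {a b c : ℝ}
    (h : IntervalIntegrable f volume a b) (hc : c ∈ Set.uIcc a b) :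
    AbsolutelyContinuousOnInterval (fun x => ∫ v in c..x, f v) a b := by
  -- Increments of the primitive of `f` are dominated by those of the primitive of `‖f‖`, so the
  -- same `δ` serves for both.
  have hn := h.norm.absolutelyContinuousOnInterval_intervalIntegral hc
  rw [absolutelyContinuousOnInterval_iff] at hn ⊢
  intro ε hε
  obtain ⟨δ, hδ, H⟩ := hn ε hε
  refine ⟨δ, hδ, fun I hI hI' => lt_of_le_of_lt (Finset.sum_le_sum fun i hi => ?_) (H I hI hI')⟩
  have hm := hI.1 i hi
  have sub : ∀ {x y : ℝ}, x ∈ Set.uIcc a b → y ∈ Set.uIcc a b → IntervalIntegrable f volume x y :=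
    fun hx hy => h.mono_set (Set.uIcc_subset_uIcc hx hy)
  rw [dist_eq_norm, dist_eq_norm,
    intervalIntegral.integral_interval_sub_left (sub hc hm.1) (sub hc hm.2),
    intervalIntegral.integral_interval_sub_left (sub hc hm.1).norm (sub hc hm.2).norm]
  exact intervalIntegral.norm_integral_le_abs_integral_norm

/-- Subtracting the primitive of `f'` leaves an absolutely continuous function with derivative zero
almost everywhere, hence a constant. The a.e. form is needed because right-hand sides on the edges
are only `L²`. -/
theorem eq_add_integral_of_absolutelyContinuous {E : Type*} [NormedAddCommGroup E]
    [NormedSpace ℝ E] [CompleteSpace E] {f f' : ℝ → E} {a b : ℝ}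
    (hf : AbsolutelyContinuousOnInterval f a b) (hi : IntervalIntegrable f' volume a b)
    (hd : ∀ᵐ x, x ∈ Set.uIcc a b → HasDerivAt f (f' x) x) :
    f b = f a + ∫ t in a..b, f' t := by
  have hg := hf.sub (absolutelyContinuousOnInterval_primitive hi Set.left_mem_uIcc)
  obtain ⟨C, hC⟩ := hg.const_of_ae_hasDerivAt_zero (by
    filter_upwards [hd, hi.ae_hasDerivAt_integral] with x h1 h2 hx
    simpa using (h1 hx).sub (h2 hx a Set.left_mem_uIcc))
  have h1 := hC a Set.left_mem_uIcc
  have h2 := hC b Set.right_mem_uIcc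
  simp only [Pi.sub_apply, intervalIntegral.integral_same, sub_zero] at h1 h2
  rw [h1, ← h2]; abel

/-! ### Solutions of the inhomogeneous equation on an edge -/

/-- The solution of `-u'' - k² u = y` with `u 0 = α`, `u' 0 = β`. -/
def edgeSol (k α β : ℂ) (y : ℝ → ℂ) (x : ℝ) : ℂ :=
  Complex.cos (k * x) * (α + (∫ t in (0 : ℝ)..x, Complex.sin (k * t) * y t) / k) +
    Complex.sin (k * x) / k * (β - ∫ t in (0 : ℝ)..x, Complex.cos (k * t) * y t)

/-- The derivative of `edgeSol`. -/
def edgeSolDeriv (k α β : ℂ) (y : ℝ → ℂ) (x : ℝ) : ℂ :=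
  -k * Complex.sin (k * x) * (α + (∫ t in (0 : ℝ)..x, Complex.sin (k * t) * y t) / k) +
    Complex.cos (k * x) * (β - ∫ t in (0 : ℝ)..x, Complex.cos (k * t) * y t)

theorem hasDerivAt_cos_mul (k : ℂ) (x : ℝ) :
    HasDerivAt (fun x : ℝ => Complex.cos (k * x)) (-k * Complex.sin (k * x)) x := by
  have h : HasDerivAt (fun w : ℂ => Complex.cos (k * w)) (-Complex.sin (k * x) * (k * 1)) (x : ℂ) :=
    ((hasDerivAt_id (x : ℂ)).const_mul k).ccos
  convert! h.comp_ofReal using 1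
  ring

theorem hasDerivAt_sin_mul (k : ℂ) (x : ℝ) :
    HasDerivAt (fun x : ℝ => Complex.sin (k * x)) (k * Complex.cos (k * x)) x := by
  have h : HasDerivAt (fun w : ℂ => Complex.sin (k * w)) (Complex.cos (k * x) * (k * 1)) (x : ℂ) :=
    ((hasDerivAt_id (x : ℂ)).const_mul k).csin
  convert! h.comp_ofReal using 1
  ring

theorem absolutelyContinuous_trig (k : ℂ) (a b : ℝ) :
    AbsolutelyContinuousOnInterval (fun x : ℝ => Complex.cos (k * x)) a b ∧
    AbsolutelyContinuousOnInterval (fun x : ℝ => Complex.sin (k * x)) a b := by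
  have h : ContDiff ℝ 1 (fun x : ℝ => k * (x : ℂ)) :=
    contDiff_const.mul Complex.ofRealCLM.contDiff
  exact ⟨((Complex.contDiff_cos.restrict_scalars ℝ).comp h).contDiffOn.absolutelyContinuousOnInterval,
    ((Complex.contDiff_sin.restrict_scalars ℝ).comp h).contDiffOn.absolutelyContinuousOnInterval⟩

variable {k α β : ℂ} {y : ℝ → ℂ} {ℓ : ℝ}

theorem absolutelyContinuous_const (c : ℂ) (a b : ℝ) :
    AbsolutelyContinuousOnInterval (fun _ : ℝ => c) a b :=
  contDiffOn_const.absolutelyContinuousOnInterval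

theorem intervalIntegrable_trig_mul (hy : IntervalIntegrable y volume 0 ℓ) (k : ℂ) :
    IntervalIntegrable (fun t : ℝ => Complex.cos (k * t) * y t) volume 0 ℓ ∧
    IntervalIntegrable (fun t : ℝ => Complex.sin (k * t) * y t) volume 0 ℓ :=
  ⟨hy.continuousOn_mul (by fun_prop), hy.continuousOn_mul (by fun_prop)⟩

theorem absolutelyContinuous_edgeSol (hy : IntervalIntegrable y volume 0 ℓ) (k α β : ℂ) :
    AbsolutelyContinuousOnInterval (edgeSol k α β y) 0 ℓ ∧
    AbsolutelyContinuousOnInterval (edgeSolDeriv k α β y) 0 ℓ := by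
  obtain ⟨hc, hs⟩ := absolutelyContinuous_trig k 0 ℓ
  have hA := (absolutelyContinuous_const α 0 ℓ).add ((absolutelyContinuous_const k⁻¹ 0 ℓ).smul
    (absolutelyContinuousOnInterval_primitive (intervalIntegrable_trig_mul hy k).2
      Set.left_mem_uIcc))
  have hB := (absolutelyContinuous_const β 0 ℓ).sub
    (absolutelyContinuousOnInterval_primitive (intervalIntegrable_trig_mul hy k).1
      Set.left_mem_uIcc)
  constructor
  · convert! (hc.smul hA).add (((absolutelyContinuous_const k⁻¹ 0 ℓ).smul hs).smul hB) using 1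
    funext x
    simp only [edgeSol, Pi.add_apply, Pi.sub_apply, Pi.mul_apply, smul_eq_mul]
    ring
  · convert! (((absolutelyContinuous_const (-k) 0 ℓ).smul hs).smul hA).add (hc.smul hB) using 1
    funext x
    simp only [edgeSolDeriv, Pi.add_apply, Pi.sub_apply, Pi.mul_apply, smul_eq_mul]
    ring

/-- Variation of constants: the derivatives of the two amplitudes cancel in `u'`, and in `u''` they
contribute `-y (sin² + cos²) = -y`. -/
theorem ae_hasDerivAt_edgeSol (hk : k ≠ 0) (hy : IntervalIntegrable y volume 0 ℓ) :
    ∀ᵐ x, x ∈ Set.uIcc 0 ℓ → HasDerivAt (edgeSol k α β y) (edgeSolDeriv k α β y x) x ∧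
      HasDerivAt (edgeSolDeriv k α β y) (-(k ^ 2 * edgeSol k α β y x + y x)) x := by
  obtain ⟨hc, hs⟩ := intervalIntegrable_trig_mul hy k
  filter_upwards [hc.ae_hasDerivAt_integral, hs.ae_hasDerivAt_integral] with x h1 h2 hx
  have hA := ((h2 hx 0 Set.left_mem_uIcc).div_const k).const_add α
  have hB := (h1 hx 0 Set.left_mem_uIcc).const_sub β
  constructor
  · convert! ((hasDerivAt_cos_mul k x).mul hA).add
      (((hasDerivAt_sin_mul k x).div_const k).mul hB) using 1
    simp only [edgeSolDeriv]
    field_simp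
    ring
  · convert! ((((hasDerivAt_sin_mul k x).const_mul (-k))).mul hA).add
      ((hasDerivAt_cos_mul k x).mul hB) using 1
    simp only [edgeSol]
    field_simp
    linear_combination (y x) * Complex.sin_sq_add_cos_sq (k * x)

theorem edgeSol_zero : edgeSol k α β y 0 = α := by simp [edgeSol]

theorem edgeSolDeriv_zero : edgeSolDeriv k α β y 0 = β := by simp [edgeSolDeriv]

theorem isNegSecondDeriv_edgeSol (hk : k ≠ 0) (y ψ : EdgeL2 ℓ)
    (hψ : (ψ : ℝ → ℂ) =ᵐ[volume.restrict (Set.Ioo 0 ℓ)] edgeSol k α β y) :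
    IsNegSecondDeriv ℓ ψ (y + k ^ 2 • ψ) (edgeSol k α β y) (edgeSolDeriv k α β y) where
  ae_eq := hψ
  eq_integral x hx := by
    have hy := y.intervalIntegrable hx
    obtain ⟨h1, h2⟩ := absolutelyContinuous_edgeSol hy k α β
    refine eq_add_integral_of_absolutelyContinuous h1 h2.continuousOn.intervalIntegrable ?_
    filter_upwards [ae_hasDerivAt_edgeSol (α := α) (β := β) hk hy] with t ht h using (ht h).1
  deriv_eq_integral x hx := by
    have hy := y.intervalIntegrable hx
    obtain ⟨h1, h2⟩ := absolutelyContinuous_edgeSol hy k α β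
    have hi : IntervalIntegrable (fun t => -(k ^ 2 * edgeSol k α β y t + y t)) volume 0 x :=
      ((h1.continuousOn.intervalIntegrable.const_mul (k ^ 2)).add hy).neg
    have key := eq_add_integral_of_absolutelyContinuous h2 hi (by
      filter_upwards [ae_hasDerivAt_edgeSol (α := α) (β := β) hk hy] with t ht h using (ht h).2)
    have hg : ((y + k ^ 2 • ψ : EdgeL2 ℓ) : ℝ → ℂ) =ᵐ[volume.restrict (Set.Ioo 0 ℓ)]
        fun t => k ^ 2 * edgeSol k α β y t + y t := by
      filter_upwards [Lp.coeFn_add y (k ^ 2 • ψ), Lp.coeFn_smul (k ^ 2) ψ, hψ] with t h1 h2 h3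
      rw [h1, Pi.add_apply, h2, Pi.smul_apply, h3, smul_eq_mul, add_comm]
    rw [intervalIntegral_congr_edge hx hg, key, intervalIntegral.integral_neg]
    ring

/-- Uniqueness for the homogeneous equation on an edge. -/
theorem IsNegSecondDeriv.eq_trig (hk : k ≠ 0) {ψ : EdgeL2 ℓ} {u du : ℝ → ℂ}
    (h : IsNegSecondDeriv ℓ ψ (k ^ 2 • ψ) u du) {x : ℝ} (hx : x ∈ Set.Icc 0 ℓ) :
    u x = u 0 * Complex.cos (k * x) + du 0 * (Complex.sin (k * x) / k) ∧
    du x = -k * u 0 * Complex.sin (k * x) + du 0 * Complex.cos (k * x) := by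
  have hg : ((k ^ 2 • ψ : EdgeL2 ℓ) : ℝ → ℂ) =ᵐ[volume.restrict (Set.Ioo 0 ℓ)]
      fun t => k ^ 2 * u t := by
    filter_upwards [Lp.coeFn_smul (k ^ 2) ψ, h.ae_eq] with t h2 h3
    rw [h2, Pi.smul_apply, h3, smul_eq_mul]
  have hℓ : 0 ≤ ℓ := hx.1.trans hx.2
  have hdu := h.continuousOn_deriv
  have hdI := h.intervalIntegrable_deriv (x := ℓ) ⟨hℓ, le_rfl⟩
  have hu : ContinuousOn u (Set.Icc 0 ℓ) := by
    have hc := intervalIntegral.continuousOn_primitive_interval' hdI Set.left_mem_uIcc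
    rw [Set.uIcc_of_le hℓ] at hc
    exact (continuousOn_const.add hc).congr h.eq_integral
  -- The right-hand side is now `k² u` with `u` continuous, so both derivatives exist at every
  -- interior point, not just almost everywhere.
  have hder : ∀ t ∈ Set.Ioo 0 ℓ, HasDerivAt u (du t) t ∧ HasDerivAt du (-(k ^ 2 * u t)) t := by
    intro t ht
    have hI := Set.Ioo_subset_Icc_self ht
    have hnh := isOpen_Ioo.mem_nhds ht
    constructor
    · have := (intervalIntegral.integral_hasDerivAt_right (h.intervalIntegrable_deriv hI)
        (ContinuousOn.stronglyMeasurableAtFilter isOpen_Ioo (hdu.mono Set.Ioo_subset_Icc_self) _ ht)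
        (hdu.continuousAt (Icc_mem_nhds ht.1 ht.2))).const_add (u 0)
      refine this.congr_of_eventuallyEq ?_
      filter_upwards [hnh] with s hs using h.eq_integral s (Set.Ioo_subset_Icc_self hs)
    · have hcu : ContinuousOn (fun t => k ^ 2 * u t) (Set.Icc 0 ℓ) := continuousOn_const.mul hu
      have hIu : IntervalIntegrable (fun t => k ^ 2 * u t) volume 0 t := by
        apply ContinuousOn.intervalIntegrable
        rw [Set.uIcc_of_le ht.1.le]
        exact hcu.mono (Set.Icc_subset_Icc_right ht.2.le)
      have := (intervalIntegral.integral_hasDerivAt_right hIu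
        (ContinuousOn.stronglyMeasurableAtFilter isOpen_Ioo (hcu.mono Set.Ioo_subset_Icc_self) _ ht)
        (hcu.continuousAt (Icc_mem_nhds ht.1 ht.2))).const_sub (du 0)
      refine this.congr_of_eventuallyEq ?_
      filter_upwards [hnh] with s hs
      rw [h.deriv_eq_integral s (Set.Ioo_subset_Icc_self hs),
        intervalIntegral_congr_edge (Set.Ioo_subset_Icc_self hs) hg]
  have const : ∀ f : ℝ → ℂ, ContinuousOn f (Set.Icc 0 ℓ) →
      (∀ t ∈ Set.Ioo 0 ℓ, HasDerivAt f 0 t) → f x = f 0 := by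
    intro f hf hf'
    have := intervalIntegral.integral_eq_sub_of_hasDerivAt_of_le hx.1
      (hf.mono (Set.Icc_subset_Icc_right hx.2))
      (fun t ht => hf' t (Set.Ioo_subset_Ioo_right hx.2 ht)) intervalIntegrable_const
    simpa [sub_eq_zero] using this.symm
  -- Rotating `(u, u')` back by the free flow gives two conserved quantities, equal to `u 0` and `du
  -- 0`. Inverting the rotation yields the two formulas.
  have e1 := const (fun t => u t * Complex.cos (k * t) - du t * (Complex.sin (k * t) / k))
    ((hu.mul (by fun_prop)).sub (hdu.mul (by fun_prop))) (fun t ht => by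
      convert! ((hder t ht).1.mul (hasDerivAt_cos_mul k t)).sub
        ((hder t ht).2.mul ((hasDerivAt_sin_mul k t).div_const k)) using 1
      field_simp
      ring)
  have e2 := const (fun t => u t * (k * Complex.sin (k * t)) + du t * Complex.cos (k * t))
    ((hu.mul (by fun_prop)).add (hdu.mul (by fun_prop))) (fun t ht => by
      convert! ((hder t ht).1.mul ((hasDerivAt_sin_mul k t).const_mul k)).add
        ((hder t ht).2.mul (hasDerivAt_cos_mul k t)) using 1
      ring)
  simp only [Complex.ofReal_zero, mul_zero, Complex.cos_zero, Complex.sin_zero, zero_div, mul_one,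
    sub_zero, zero_add] at e1 e2
  rw [← e1, ← e2]
  have hsc := Complex.sin_sq_add_cos_sq (k * x)
  constructor
  · field_simp
    linear_combination (-(k * u x)) * hsc
  · field_simp
    linear_combination (-(du x)) * hsc

end

section

variable {ℓ : ℝ}

/-! ### Bounded operators on the space of an edge -/

theorem EdgeL2.exists_integral_norm_le (ℓ : ℝ) :
    ∃ C : ℝ, 0 ≤ C ∧ ∀ y : EdgeL2 ℓ, ∫ t in Set.Ioo 0 ℓ, ‖y t‖ ≤ C * ‖y‖ := by
  set μ := volume.restrict (Set.Ioo (0 : ℝ) ℓ) with hμ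
  refine ⟨(μ Set.univ ^ (1 / (1 : ENNReal).toReal - 1 / (2 : ENNReal).toReal)).toReal,
    ENNReal.toReal_nonneg, fun y => ?_⟩
  have hm := Lp.aestronglyMeasurable y
  rw [integral_norm_eq_lintegral_enorm hm, ← eLpNorm_one_eq_lintegral_enorm, Lp.norm_def, mul_comm,
    ← ENNReal.toReal_mul]
  refine ENNReal.toReal_mono (ENNReal.mul_ne_top (Lp.eLpNorm_ne_top y) ?_)
    (eLpNorm_le_eLpNorm_mul_rpow_measure_univ (by norm_num) hm)
  exact ENNReal.rpow_ne_top_of_nonneg (by norm_num) (measure_ne_top μ _)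

theorem EdgeL2.norm_integral_le (y : EdgeL2 ℓ) {w : ℝ → ℂ} {M : ℝ}
    (hM : ∀ t ∈ Set.Icc 0 ℓ, ‖w t‖ ≤ M) {x : ℝ} (hx : x ∈ Set.Icc 0 ℓ) :
    ‖∫ t in (0 : ℝ)..x, w t * y t‖ ≤ M * ∫ t in Set.Ioo 0 ℓ, ‖y t‖ := by
  have h1 : Integrable (y : ℝ → ℂ) (volume.restrict (Set.Ioo 0 ℓ)) :=
    (Lp.memLp y).integrable (by norm_num)
  have hM0 : 0 ≤ M := (norm_nonneg _).trans (hM x hx)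
  rw [intervalIntegral.integral_of_le hx.1, ← integral_Icc_eq_integral_Ioc,
    integral_Icc_eq_integral_Ioo, ← integral_const_mul]
  have hsub : Set.Ioo 0 x ⊆ Set.Ioo 0 ℓ := Set.Ioo_subset_Ioo_right hx.2
  refine (norm_integral_le_of_norm_le ((h1.norm.mono_measure
    (Measure.restrict_mono_set _ hsub)).const_mul M) ?_).trans ?_
  · rw [ae_restrict_iff' measurableSet_Ioo]
    filter_upwards with t ht
    rw [norm_mul]
    gcongr
    exact hM t (Set.Ioo_subset_Icc_self (hsub ht))
  · exact setIntegral_mono_set (h1.norm.const_mul M)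
      (ae_of_all _ fun t => by positivity) (ae_of_all _ hsub)

theorem exists_primitive_clm {w : ℝ → ℂ} (hw : Continuous w) {x : ℝ} (hx : x ∈ Set.Icc 0 ℓ) :
    ∃ T : EdgeL2 ℓ →L[ℂ] ℂ, ∀ y, T y = ∫ t in (0 : ℝ)..x, w t * y t := by
  obtain ⟨M, hM⟩ := isCompact_Icc.exists_bound_of_continuousOn (s := Set.Icc 0 ℓ) hw.continuousOn
  obtain ⟨C, hC0, hC⟩ := EdgeL2.exists_integral_norm_le ℓ
  have hM0 : 0 ≤ M := (norm_nonneg _).trans (hM x hx)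
  have hI : ∀ y : EdgeL2 ℓ, IntervalIntegrable (fun t => w t * y t) volume 0 x := fun y =>
    (y.intervalIntegrable hx).continuousOn_mul hw.continuousOn
  let L : EdgeL2 ℓ →ₗ[ℂ] ℂ :=
    { toFun := fun y => ∫ t in (0 : ℝ)..x, w t * y t
      map_add' := fun y z => by
        rw [← intervalIntegral.integral_add (hI y) (hI z)]
        refine intervalIntegral_congr_edge hx ?_
        filter_upwards [Lp.coeFn_add y z] with t ht
        rw [ht, Pi.add_apply, mul_add]
      map_smul' := fun c y => by
        rw [RingHom.id_apply, ← intervalIntegral.integral_smul]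
        refine intervalIntegral_congr_edge hx ?_
        filter_upwards [Lp.coeFn_smul c y] with t ht
        rw [ht, Pi.smul_apply, smul_eq_mul, smul_eq_mul]
        ring }
  refine ⟨L.mkContinuous (M * C) fun y => ?_, fun y => rfl⟩
  refine (EdgeL2.norm_integral_le y hM hx).trans ?_
  rw [mul_assoc]
  gcongr
  exact hC y

theorem memLp_edge_of_continuousOn {f : ℝ → ℂ} (hf : ContinuousOn f (Set.Icc 0 ℓ)) :
    MemLp f 2 (volume.restrict (Set.Ioo 0 ℓ)) := by
  obtain ⟨M, hM⟩ := isCompact_Icc.exists_bound_of_continuousOn hf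
  refine MemLp.of_bound ((hf.mono Set.Ioo_subset_Icc_self).aestronglyMeasurable
    measurableSet_Ioo) M ?_
  rw [ae_restrict_iff' measurableSet_Ioo]
  exact ae_of_all _ fun t ht => hM t (Set.Ioo_subset_Icc_self ht)

theorem continuousOn_edgeSol (hℓ : 0 ≤ ℓ) (k α β : ℂ) (y : EdgeL2 ℓ) :
    ContinuousOn (edgeSol k α β y) (Set.Icc 0 ℓ) := by
  have := (absolutelyContinuous_edgeSol (y.intervalIntegrable (x := ℓ) ⟨hℓ, le_rfl⟩) k α β).1.continuousOn
  rwa [Set.uIcc_of_le hℓ] at this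

theorem edgeSol_eq_add (k α β : ℂ) (y : ℝ → ℂ) (x : ℝ) :
    edgeSol k α β y x = α * Complex.cos (k * x) + β * (Complex.sin (k * x) / k) +
      edgeSol k 0 0 y x := by
  simp only [edgeSol]; ring

/-- The solution operator of the inhomogeneous equation with zero initial data. -/
theorem exists_volterra_clm (hℓ : 0 ≤ ℓ) (k : ℂ) :
    ∃ V : EdgeL2 ℓ →L[ℂ] EdgeL2 ℓ, ∀ y : EdgeL2 ℓ,
      (V y : ℝ → ℂ) =ᵐ[volume.restrict (Set.Ioo 0 ℓ)] edgeSol k 0 0 y := by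
  have hcc : Continuous fun t : ℝ => Complex.cos (k * t) := by fun_prop
  have hcs : Continuous fun t : ℝ => Complex.sin (k * t) := by fun_prop
  have hadd : ∀ y z : EdgeL2 ℓ, ∀ x ∈ Set.Icc 0 ℓ,
      edgeSol k 0 0 (y + z : EdgeL2 ℓ) x = edgeSol k 0 0 y x + edgeSol k 0 0 z x := by
    intro y z x hx
    obtain ⟨T, hT⟩ := exists_primitive_clm hcc hx
    obtain ⟨S, hS⟩ := exists_primitive_clm hcs hx
    simp only [edgeSol, ← hT, ← hS, map_add]
    ring
  have hsmul : ∀ (c : ℂ) (y : EdgeL2 ℓ), ∀ x ∈ Set.Icc 0 ℓ,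
      edgeSol k 0 0 (c • y : EdgeL2 ℓ) x = c * edgeSol k 0 0 y x := by
    intro c y x hx
    obtain ⟨T, hT⟩ := exists_primitive_clm hcc hx
    obtain ⟨S, hS⟩ := exists_primitive_clm hcs hx
    simp only [edgeSol, ← hT, ← hS, map_smul, smul_eq_mul]
    ring
  have hmem := fun y : EdgeL2 ℓ => memLp_edge_of_continuousOn (continuousOn_edgeSol hℓ k 0 0 y)
  let L : EdgeL2 ℓ →ₗ[ℂ] EdgeL2 ℓ :=
    { toFun := fun y => (hmem y).toLp
      map_add' := fun y z => by
        apply Lp.ext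
        filter_upwards [(hmem (y + z)).coeFn_toLp, Lp.coeFn_add (hmem y).toLp (hmem z).toLp,
          (hmem y).coeFn_toLp, (hmem z).coeFn_toLp, ae_restrict_mem measurableSet_Ioo]
          with x h1 h2 h3 h4 hx
        rw [h1, h2, Pi.add_apply, h3, h4, hadd y z x (Set.Ioo_subset_Icc_self hx)]
      map_smul' := fun c y => by
        apply Lp.ext
        filter_upwards [(hmem (c • y)).coeFn_toLp, Lp.coeFn_smul c (hmem y).toLp,
          (hmem y).coeFn_toLp, ae_restrict_mem measurableSet_Ioo] with x h1 h2 h3 hx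
        rw [h1, RingHom.id_apply, h2, Pi.smul_apply, h3, smul_eq_mul,
          hsmul c y x (Set.Ioo_subset_Icc_self hx)] }
  obtain ⟨M, hM⟩ := isCompact_Icc.exists_bound_of_continuousOn (s := Set.Icc 0 ℓ) hcc.continuousOn
  obtain ⟨N, hN⟩ := isCompact_Icc.exists_bound_of_continuousOn (s := Set.Icc 0 ℓ) hcs.continuousOn
  have hM0 : 0 ≤ M := (norm_nonneg _).trans (hM 0 ⟨le_rfl, hℓ⟩)
  have hN0 : 0 ≤ N := (norm_nonneg _).trans (hN 0 ⟨le_rfl, hℓ⟩)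
  obtain ⟨C, hC0, hC⟩ := EdgeL2.exists_integral_norm_le ℓ
  set μ := volume.restrict (Set.Ioo (0 : ℝ) ℓ) with hμ
  -- The `L²` norm is at most the square root of the length times a sup bound; each of the two terms
  -- of `edgeSol` contributes `M N C / ‖k‖` to the latter.
  refine ⟨L.mkContinuous (measureUnivNNReal μ ^ (2 : ENNReal).toReal⁻¹ * (2 * M * N * C / ‖k‖))
    fun y => ?_, fun y => (hmem y).coeFn_toLp⟩
  have hb : ∀ᵐ x ∂μ, ‖L y x‖ ≤ 2 * M * N * C / ‖k‖ * ‖y‖ := by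
    filter_upwards [(hmem y).coeFn_toLp, ae_restrict_mem measurableSet_Ioo] with x h1 hx
    have hx' := Set.Ioo_subset_Icc_self hx
    have h1' : L y x = edgeSol k 0 0 y x := h1
    rw [h1']
    have e1 := (EdgeL2.norm_integral_le y hM hx').trans
      (mul_le_mul_of_nonneg_left (hC y) hM0)
    have e2 := (EdgeL2.norm_integral_le y hN hx').trans
      (mul_le_mul_of_nonneg_left (hC y) hN0)
    simp only [edgeSol, zero_add, zero_sub]
    refine (norm_add_le _ _).trans ?_
    rw [norm_mul, norm_mul, norm_div, norm_div, norm_neg]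
    calc _ ≤ M * (N * (C * ‖y‖) / ‖k‖) + N / ‖k‖ * (M * (C * ‖y‖)) := by
          gcongr
          · exact hM x hx'
          · exact hN x hx'
      _ = _ := by ring
  have := Lp.norm_le_of_ae_bound (f := L y) (by positivity) hb
  rwa [← mul_assoc] at this

/-- The amplitudes of a solution of the homogeneous equation are controlled by its norm. -/
theorem exists_trace_bound (hℓ : 0 < ℓ) {k : ℂ} (hk : k ≠ 0) :
    ∃ C : ℝ, ∀ (ψ : EdgeL2 ℓ) (u du : ℝ → ℂ), IsNegSecondDeriv ℓ ψ (k ^ 2 • ψ) u du →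
      ‖u 0‖ ≤ C * ‖ψ‖ ∧ ‖du 0‖ ≤ C * ‖ψ‖ := by
  have hc : MemLp (fun t : ℝ => Complex.cos (k * t)) 2 (volume.restrict (Set.Ioo 0 ℓ)) :=
    memLp_edge_of_continuousOn (by fun_prop)
  have hs : MemLp (fun t : ℝ => Complex.sin (k * t) / k) 2 (volume.restrict (Set.Ioo 0 ℓ)) :=
    memLp_edge_of_continuousOn (by fun_prop)
  -- `T` maps initial data to the homogeneous solution. It is injective because the Wronskian of
  -- `cos` and `sin / k` is nonzero, and an injective linear map on a finite-dimensional space is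
  -- bounded below; that lower bound is the claim.
  let T : ℂ × ℂ →ₗ[ℂ] EdgeL2 ℓ :=
    (LinearMap.toSpanSingleton ℂ (EdgeL2 ℓ) hc.toLp).coprod
      (LinearMap.toSpanSingleton ℂ (EdgeL2 ℓ) hs.toLp)
  have hT : ∀ p : ℂ × ℂ, (T p : ℝ → ℂ) =ᵐ[volume.restrict (Set.Ioo 0 ℓ)]
      fun t : ℝ => p.1 * Complex.cos (k * t) + p.2 * (Complex.sin (k * t) / k) := by
    intro p
    have : T p = p.1 • hc.toLp + p.2 • hs.toLp := by simp [T]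
    rw [this]
    filter_upwards [Lp.coeFn_add (p.1 • hc.toLp) (p.2 • hs.toLp), Lp.coeFn_smul p.1 hc.toLp,
      Lp.coeFn_smul p.2 hs.toLp, hc.coeFn_toLp, hs.coeFn_toLp] with t h1 h2 h3 h4 h5
    rw [h1, Pi.add_apply, h2, h3, Pi.smul_apply, Pi.smul_apply, h4, h5, smul_eq_mul, smul_eq_mul]
  have hker : LinearMap.ker T = ⊥ := by
    rw [LinearMap.ker_eq_bot']
    intro p hp
    have h0 := hT p
    rw [hp] at h0
    have heq : Set.EqOn (fun t : ℝ => p.1 * Complex.cos (k * t) + p.2 * (Complex.sin (k * t) / k)) 0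
        (Set.Ioo 0 ℓ) :=
      Measure.eqOn_Ioo_of_ae_eq volume (h0.symm.trans (Lp.coeFn_zero _ _ _))
        (by fun_prop) continuousOn_const
    have hd : ∀ t ∈ Set.Ioo 0 ℓ, -k * p.1 * Complex.sin (k * t) + p.2 * Complex.cos (k * t) = 0 := by
      intro t ht
      have d1 := ((hasDerivAt_cos_mul k t).const_mul p.1).add
        (((hasDerivAt_sin_mul k t).div_const k).const_mul p.2)
      have d2 : HasDerivAt ((fun t : ℝ => p.1 * Complex.cos (k * t)) +
          fun t : ℝ => p.2 * (Complex.sin (k * t) / k)) 0 t := by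
        refine (hasDerivAt_const t (0 : ℂ)).congr_of_eventuallyEq ?_
        filter_upwards [isOpen_Ioo.mem_nhds ht] with s hs using heq hs
      have := d1.unique d2
      field_simp at this
      linear_combination this
    have hm : ℓ / 2 ∈ Set.Ioo 0 ℓ := ⟨by linarith, by linarith⟩
    have e1 := heq hm
    have e2 := hd _ hm
    simp only [Pi.zero_apply] at e1
    field_simp at e1
    have hsc := Complex.sin_sq_add_cos_sq (k * (ℓ / 2 : ℝ))
    have p1 : k * p.1 = 0 := by
      linear_combination (-(k * p.1)) * hsc + Complex.cos (k * (ℓ / 2 : ℝ)) * e1 -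
        Complex.sin (k * (ℓ / 2 : ℝ)) * e2
    have p2 : p.2 = 0 := by
      linear_combination (-p.2) * hsc + Complex.sin (k * (ℓ / 2 : ℝ)) * e1 +
        Complex.cos (k * (ℓ / 2 : ℝ)) * e2
    exact Prod.ext (by simpa [hk] using p1) p2
  obtain ⟨K, -, hK⟩ := T.exists_antilipschitzWith hker
  refine ⟨K, fun ψ u du h => ?_⟩
  have hψ : ψ = T (u 0, du 0) := by
    apply Lp.ext
    filter_upwards [h.ae_eq, hT (u 0, du 0), ae_restrict_mem measurableSet_Ioo] with t h1 h2 ht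
    rw [h1, h2, (h.eq_trig hk (Set.Ioo_subset_Icc_self ht)).1]
  have hb := hK.le_mul_dist (u 0, du 0) 0
  rw [map_zero, dist_zero_right, dist_zero_right, ← hψ] at hb
  exact ⟨(norm_fst_le _).trans hb, (norm_snd_le _).trans hb⟩

/-! ### Operators into `ℓ^p`-sums -/

/-- A linear map into an `ℓ^p`-sum with continuous coordinates is continuous. -/
theorem exists_clm_lp {X : Type*} [NormedAddCommGroup X] [NormedSpace ℂ X] [CompleteSpace X]
    {ι : Type*} {E : ι → Type*} [∀ i, NormedAddCommGroup (E i)] [∀ i, NormedSpace ℂ (E i)]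
    [∀ i, CompleteSpace (E i)] {p : ENNReal} [Fact (1 ≤ p)]
    (T : ∀ i, X →L[ℂ] E i) (hT : ∀ x, Memℓp (fun i => T i x) p) :
    ∃ S : X →L[ℂ] lp E p, ∀ x i, S x i = T i x := by
  let L : X →ₗ[ℂ] lp E p :=
    { toFun := fun x => ⟨fun i => T i x, hT x⟩
      map_add' := fun x y => by ext i; exact map_add (T i) x y
      map_smul' := fun c x => by ext i; exact map_smul (T i) c x }
  -- Closed graph theorem: limits in the sum are identified coordinate by coordinate, so no uniform
  -- norm estimate is required.
  refine ⟨ContinuousLinearMap.ofSeqClosedGraph (g := L) fun v x y hv hL => ?_, fun x i => rfl⟩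
  ext i
  have h1 := ((lp.evalCLM ℂ E p i).continuous.tendsto y).comp hL
  have h2 := ((T i).continuous.tendsto x).comp hv
  exact tendsto_nhds_unique h1 h2

theorem memℓp_comp_injective {ι κ : Type*} {E : ι → Type*} [∀ i, NormedAddCommGroup (E i)]
    {f : ∀ i, E i} (hf : Memℓp f 2) {g : κ → ι} (hg : Function.Injective g) :
    Memℓp (fun j => f (g j)) 2 := by
  rw [memℓp_gen_iff (by norm_num)] at hf ⊢
  exact hf.comp_injective hg

theorem memℓp_clm {ι E F : Type*} [NormedAddCommGroup E] [NormedSpace ℂ E]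
    [NormedAddCommGroup F] [NormedSpace ℂ F] (T : E →L[ℂ] F) {f : ι → E} (hf : Memℓp f 2) :
    Memℓp (fun i => T (f i)) 2 :=
  (hf.norm.const_mul ‖T‖).mono fun i => T.le_opNorm (f i)

end

section

/-! ### The difference equation on the lattice -/

/-- The space `ℓ²(ℤ)`. -/
abbrev LatticeL2 : Type := lp (fun _ : ℤ => ℂ) 2

theorem memℓp_geometric {μ : ℂ} (hμ : ‖μ‖ < 1) : Memℓp (fun j : ℤ => μ ^ j.natAbs) 2 := by
  rw [memℓp_gen_iff (by norm_num)]
  have hs : Summable fun n : ℕ => ‖μ ^ n‖ ^ (2 : ENNReal).toReal := by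
    have : (fun n : ℕ => ‖μ ^ n‖ ^ (2 : ENNReal).toReal) = fun n : ℕ => (‖μ‖ ^ 2) ^ n := by
      funext n
      rw [ENNReal.toReal_ofNat, Real.rpow_ofNat, norm_pow, pow_right_comm]
    rw [this]
    exact summable_geometric_of_lt_one (by positivity) (pow_lt_one₀ (norm_nonneg _) hμ (by norm_num))
  exact Summable.of_nat_of_neg (by simpa using hs) (by simpa using hs)

/-- The sequence `μ ^ |j|` is, up to the factor `μ - μ⁻¹`, the Green function of the free recursion.
It serves both as the eigenvector and as the rank-one correction in the resolvent. -/
theorem geometric_recursion {μ F : ℂ} (hμ : μ ≠ 0) (hF : μ + μ⁻¹ = 2 * F) (j : ℤ) :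
    μ ^ (j + 1).natAbs + μ ^ (j - 1).natAbs - 2 * F * μ ^ j.natAbs =
      if j = 0 then μ - μ⁻¹ else 0 := by
  rw [← hF]
  rcases lt_trichotomy j 0 with h | h | h
  · obtain ⟨n, rfl⟩ : ∃ n : ℕ, j = -((n : ℤ) + 1) := ⟨(-j - 1).toNat, by omega⟩
    have e1 : (-((n : ℤ) + 1) + 1).natAbs = n := by omega
    have e2 : (-((n : ℤ) + 1) - 1).natAbs = n + 2 := by omega
    have e3 : (-((n : ℤ) + 1)).natAbs = n + 1 := by omega
    rw [e1, e2, e3, if_neg (by omega)]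
    field_simp
    ring
  · subst h
    simp
  · obtain ⟨n, rfl⟩ : ∃ n : ℕ, j = (n : ℤ) + 1 := ⟨(j - 1).toNat, by omega⟩
    have e1 : ((n : ℤ) + 1 + 1).natAbs = n + 2 := by omega
    have e2 : ((n : ℤ) + 1 - 1).natAbs = n := by omega
    have e3 : ((n : ℤ) + 1).natAbs = n + 1 := by omega
    rw [e1, e2, e3, if_neg (by omega)]
    field_simp
    ring

/-- A decaying solution of the free recursion on a half-line is geometric. -/
theorem eq_geometric_of_decay {μ F : ℂ} (hμ0 : μ ≠ 0) (hμ : ‖μ‖ ≤ 1) (hF : μ + μ⁻¹ = 2 * F)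
    {p : ℕ → ℂ} (hp : ∀ n, p (n + 2) + p n = 2 * F * p (n + 1))
    (h0 : Filter.Tendsto p Filter.atTop (nhds 0)) (n : ℕ) : p n = μ ^ n * p 0 := by
  -- The quantity `d n = p (n+1) - μ p n` satisfies `d n = μ d (n+1)`, so `‖d n‖ ≤ ‖d (n+m)‖`, which
  -- tends to 0 with `m`. This needs only `‖μ‖ ≤ 1`, so band energies are covered as well.
  have hstep : ∀ n, p (n + 1) - μ * p n = μ * (p (n + 2) - μ * p (n + 1)) := by
    intro n
    have h1 := hp n
    rw [← hF] at h1
    field_simp at h1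
    linear_combination -h1
  have hiter : ∀ n m, p (n + 1) - μ * p n = μ ^ m * (p (n + m + 1) - μ * p (n + m)) := by
    intro n m
    induction m with
    | zero => simp
    | succ m ih =>
      rw [ih, hstep (n + m), pow_succ]
      ring_nf
  have hd : ∀ n, p (n + 1) - μ * p n = 0 := by
    intro n
    have ht : Filter.Tendsto (fun m => p (n + m + 1) - μ * p (n + m)) Filter.atTop (nhds 0) := by
      have h1 : Filter.Tendsto (fun m => p (n + m)) Filter.atTop (nhds 0) :=
        h0.comp (Filter.tendsto_atTop_mono (fun m => Nat.le_add_left m n) Filter.tendsto_id)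
      have h2 : Filter.Tendsto (fun m => p (n + m + 1)) Filter.atTop (nhds 0) :=
        h0.comp (Filter.tendsto_atTop_mono (fun m => by simp only [id]; omega) Filter.tendsto_id)
      simpa using h2.sub (h1.const_mul μ)
    have hle : ∀ m, ‖p (n + 1) - μ * p n‖ ≤ ‖p (n + m + 1) - μ * p (n + m)‖ := by
      intro m
      rw [hiter n m, norm_mul, norm_pow]
      exact mul_le_of_le_one_left (norm_nonneg _) (pow_le_one₀ (norm_nonneg _) hμ)
    have := ge_of_tendsto' ht.norm hle
    rw [norm_zero] at this
    exact norm_le_zero_iff.1 this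
  induction n with
  | zero => simp
  | succ n ih => rw [pow_succ]; linear_combination hd n + μ * ih

/-- Decaying solutions of the recursion with a defect at the origin. -/
theorem defect_recursion {μ F s : ℂ} (hμ0 : μ ≠ 0) (hμ : ‖μ‖ ≤ 1) (hF : μ + μ⁻¹ = 2 * F)
    {p : ℤ → ℂ} (hp : ∀ j, p (j + 1) + p (j - 1) - 2 * F * p j = if j = 0 then s * p 0 else 0)
    (h0 : Filter.Tendsto p Filter.cofinite (nhds 0)) :
    (∀ j, p j = μ ^ j.natAbs * p 0) ∧ (μ - μ⁻¹ - s) * p 0 = 0 := by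
  have inj1 : Function.Injective (fun n : ℕ => (n : ℤ)) := Nat.cast_injective
  have inj2 : Function.Injective (fun n : ℕ => -(n : ℤ)) := fun m n h => by simpa using h
  have hpos := eq_geometric_of_decay hμ0 hμ hF (p := fun n : ℕ => p n)
    (fun n => by
      have h1 := hp ((n : ℤ) + 1)
      rw [if_neg (by omega), show (n : ℤ) + 1 + 1 = (n + 2 : ℕ) by push_cast; ring,
        add_sub_cancel_right] at h1
      push_cast at h1 ⊢
      linear_combination h1)
    (by rw [← Nat.cofinite_eq_atTop]; exact h0.comp inj1.tendsto_cofinite)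
  have hneg := eq_geometric_of_decay hμ0 hμ hF (p := fun n : ℕ => p (-n))
    (fun n => by
      have h1 := hp (-((n : ℤ) + 1))
      rw [if_neg (by omega), show -((n : ℤ) + 1) + 1 = -n by ring,
        show -((n : ℤ) + 1) - 1 = -(n + 2 : ℕ) by push_cast; ring] at h1
      push_cast at h1 ⊢
      linear_combination h1)
    (by rw [← Nat.cofinite_eq_atTop]; exact h0.comp inj2.tendsto_cofinite)
  constructor
  · intro j
    obtain ⟨n, rfl | rfl⟩ := j.eq_nat_or_neg
    · simpa using hpos n
    · simpa using hneg n
  · have h1 := hpos 1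
    have h2 := hneg 1
    have h3 := hp 0
    simp only [pow_one, Nat.cast_one, Nat.cast_zero, neg_zero] at h1 h2
    rw [if_pos rfl, zero_add, zero_sub, h1, h2, ← hF] at h3
    linear_combination h3

theorem exists_shift (m : ℤ) :
    ∃ U : LatticeL2 →L[ℂ] LatticeL2, ‖U‖ ≤ 1 ∧ ∀ f j, U f j = f (j + m) := by
  obtain ⟨U, hU⟩ := exists_clm_lp (p := 2) (E := fun _ : ℤ => ℂ)
    (fun j => lp.evalCLM ℂ (fun _ : ℤ => ℂ) 2 (j + m))
    (fun f => memℓp_comp_injective (lp.memℓp f) (add_left_injective m))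
  have hU' : ∀ f j, U f j = f (j + m) := hU
  refine ⟨U, ContinuousLinearMap.opNorm_le_bound _ zero_le_one fun f => ?_, hU'⟩
  rw [one_mul, lp.norm_eq_tsum_rpow (by norm_num), lp.norm_eq_tsum_rpow (by norm_num)]
  simp only [hU']
  exact le_of_eq (congrArg (· ^ (1 / (2 : ENNReal).toReal))
    ((Equiv.addRight m).tsum_eq fun i => ‖f i‖ ^ (2 : ENNReal).toReal))

/-- The lattice operator with a defect at the origin is boundedly invertible unless the
decaying geometric sequence solves it. -/
theorem exists_lattice_inverse {μ F s : ℂ} (hμ0 : μ ≠ 0) (hμ : ‖μ‖ < 1) (hF : μ + μ⁻¹ = 2 * F)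
    (hs : μ - μ⁻¹ - s ≠ 0) :
    ∃ Q : LatticeL2 →L[ℂ] LatticeL2, ∀ h j,
      Q h (j + 1) + Q h (j - 1) - 2 * F * Q h j - (if j = 0 then s * Q h 0 else 0) = h j := by
  obtain ⟨U, hU1, hU⟩ := exists_shift 1
  obtain ⟨V, hV1, hV⟩ := exists_shift (-1)
  have unit : ∀ T : LatticeL2 →L[ℂ] LatticeL2, ‖T‖ ≤ 1 → IsUnit (1 - μ • T) := fun T hT =>
    isUnit_one_sub_of_norm_lt_one (by
      rw [norm_smul]
      exact (mul_le_of_le_one_right (norm_nonneg _) hT).trans_lt hμ)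
  obtain ⟨A, hA⟩ := unit U hU1
  obtain ⟨B, hB⟩ := unit V hV1
  -- Since the shifts `U` and `V` are mutually inverse, `U + V - (μ + μ⁻¹) = -μ⁻¹ (1 - μ U)(1 - μ
  -- V)`; `Q0` is the inverse of this product.
  let Q0 : LatticeL2 →L[ℂ] LatticeL2 := (-μ) • ((B⁻¹ : Units _).val * (A⁻¹ : Units _).val)
  have hQ0 : ∀ h j, Q0 h (j + 1) + Q0 h (j - 1) - 2 * F * Q0 h j = h j := by
    intro h j
    have key : (1 - μ • U) * (1 - μ • V) * Q0 = (-μ) • 1 := by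
      simp only [Q0]
      rw [← hA, ← hB, mul_smul_comm]
      congr 1
      rw [mul_assoc, ← mul_assoc B.val, Units.mul_inv, one_mul, Units.mul_inv]
    have dU : ∀ (f : LatticeL2) i, (1 - μ • U) f i = f i - μ * f (i + 1) := fun f i => by
      rw [← hU]; rfl
    have dV : ∀ (f : LatticeL2) i, (1 - μ • V) f i = f i - μ * f (i - 1) := fun f i => by
      rw [sub_eq_add_neg i 1, ← hV]; rfl
    have h1 : (1 - μ • U) ((1 - μ • V) (Q0 h)) j = -μ * h j :=
      congrArg (fun T : LatticeL2 →L[ℂ] LatticeL2 => T h j) key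
    rw [dU, dV, dV, add_sub_cancel_right] at h1
    rw [← hF]
    field_simp
    refine mul_left_cancel₀ hμ0 ?_
    linear_combination (-μ) * h1
  let v : LatticeL2 := ⟨fun j : ℤ => μ ^ j.natAbs, memℓp_geometric hμ⟩
  have hv : ∀ j, v j = μ ^ j.natAbs := fun j => rfl
  -- The corrected solution is `Q0 h + c v`. The defect equation at the origin forces `c (μ - μ⁻¹) =
  -- s (Q0 h 0 + c)`, which gives this `c`.
  let c : LatticeL2 →L[ℂ] ℂ := (s / (μ - μ⁻¹ - s)) • (lp.evalCLM ℂ (fun _ : ℤ => ℂ) 2 0 ∘L Q0)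
  have hc : ∀ h, c h = s / (μ - μ⁻¹ - s) * Q0 h 0 := fun h => rfl
  refine ⟨Q0 + c.smulRight v, fun h j => ?_⟩
  have hQ : ∀ j, (Q0 + c.smulRight v) h j = Q0 h j + c h * μ ^ j.natAbs := by
    intro j
    rw [add_apply, ContinuousLinearMap.smulRight_apply, lp.coeFn_add,
      Pi.add_apply, lp.coeFn_smul, Pi.smul_apply, smul_eq_mul, hv]
  simp only [hQ]
  have h1 := hQ0 h j
  have h2 := geometric_recursion hμ0 hF j
  by_cases hj : j = 0
  · subst hj
    rw [if_pos rfl] at h2 ⊢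
    have h3 : c h * (μ - μ⁻¹ - s) = s * Q0 h 0 := by
      rw [hc, mul_right_comm, div_mul_cancel₀ _ hs]
    simp only [Int.natAbs_zero, pow_zero] at h2 ⊢
    linear_combination h1 + c h * h2 + h3
  · rw [if_neg hj] at h2 ⊢
    linear_combination h1 + c h * h2

/-! ### The equation for the vertex values -/

/-- Half of the coefficient of the vertex value in the difference equation for the homogeneous
comb at energy `k²`. -/
def disc (a b γ θ : ℝ) (k : ℂ) : ℂ :=
  Complex.cos (k * a) + Complex.sin (k * a) / Complex.sin (k * b) *
    (Complex.cos (k * b) - Complex.cos θ) + γ * Complex.sin (k * a) / (2 * k)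

/-- The defect term of the difference equation at energy `k²`. -/
def defect (a γ γ' : ℝ) (k : ℂ) : ℂ := (γ' - γ) * Complex.sin (k * a) / k

theorem coupling_mul (γ γ' : ℝ) (j : ℤ) :
    (coupling γ γ' j : ℂ) = γ + if j = 0 then ((γ' : ℂ) - γ) else 0 := by
  unfold coupling
  split_ifs <;> simp

theorem exp_mul_I_facts (θ : ℝ) :
    Complex.exp (θ * Complex.I) * Complex.exp (-(θ * Complex.I)) = 1 ∧
    Complex.exp (θ * Complex.I) + Complex.exp (-(θ * Complex.I)) = 2 * Complex.cos θ := by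
  constructor
  · rw [← Complex.exp_add]; simp
  · rw [Complex.cos]; ring_nf

theorem trig_half (k : ℂ) (b : ℝ) :
    Complex.sin (k * b) = 2 * Complex.sin (k * (b / 2 : ℝ)) * Complex.cos (k * (b / 2 : ℝ)) ∧
    Complex.cos (k * b) = Complex.cos (k * (b / 2 : ℝ)) ^ 2 - Complex.sin (k * (b / 2 : ℝ)) ^ 2 := by
  have : k * b = 2 * (k * (b / 2 : ℝ)) := by push_cast; ring
  rw [this, Complex.sin_two_mul, Complex.cos_two_mul']
  exact ⟨rfl, rfl⟩

variable {a b γ γ' θ : ℝ} {k : ℂ}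

/-- The vertex values of a solution of the homogeneous equation satisfy the difference equation. -/
theorem vertex_recursion (ha : 0 < a) (hb : 0 < b) (hk : k ≠ 0)
    (hsb : Complex.sin (k * b) ≠ 0) {ψ : CombL2 a b} {u du : Edge → ℝ → ℂ}
    (h : ∀ e, IsNegSecondDeriv (len a b e) (ψ e) (k ^ 2 • ψ e) (u e) (du e))
    (hv : VertexConditions a b γ γ' θ u du) (j : ℤ) :
    u (.hor (j + 1)) a + u (.hor (j - 1)) a - 2 * disc a b γ θ k * u (.hor j) a =
      if j = 0 then defect a γ γ' k * u (.hor 0) a else 0 := by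
  have hH : ∀ j : ℤ, _ := fun j => (h (.hor j)).eq_trig hk (x := a) ⟨ha.le, le_rfl⟩
  have hU := (h (.up j)).eq_trig hk (x := b / 2) ⟨by positivity, le_rfl⟩
  have hD := (h (.down j)).eq_trig hk (x := b / 2) ⟨by positivity, le_rfl⟩
  obtain ⟨h1, h2⟩ := hH j
  obtain ⟨h3, -⟩ := hH (j + 1)
  obtain ⟨h4, h5⟩ := hU
  obtain ⟨h6, h7⟩ := hD
  have c0 := hv.cont_right (j - 1)
  rw [sub_add_cancel] at c0
  have c1 := hv.cont_right j
  have c2 := hv.cont_up j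
  have c3 := hv.cont_down j
  have hd := hv.delta j
  have q1 := hv.quasi j
  have q2 := hv.quasi_deriv j
  obtain ⟨z1, z2⟩ := exp_mul_I_facts θ
  obtain ⟨t1, t2⟩ := trig_half k b
  have hsc := Complex.sin_sq_add_cos_sq (k * a)
  have hscb := Complex.sin_sq_add_cos_sq (k * b)
  rw [c0] at h1 h2
  rw [c1] at h3
  rw [c2] at h4 h5
  rw [c3] at h6
  rw [coupling_mul, h7] at hd
  rw [h4] at q1
  rw [h5] at q2
  have hR : (if j = 0 then defect a γ γ' k * u (.hor 0) a else 0) =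
      (if j = 0 then ((γ' : ℂ) - γ) else 0) * Complex.sin (k * a) / k * u (.hor j) a := by
    split_ifs with hj
    · rw [hj, defect]
    · simp
  rw [hR]
  unfold disc
  generalize (if j = 0 then ((γ' : ℂ) - γ) else 0) = g at hd ⊢
  generalize u (.hor (j - 1)) a = p₀ at *
  generalize du (.hor j) a = d₁ at *
  generalize u (.hor j) a = p at *
  generalize u (.hor (j + 1)) a = p₁ at *
  generalize du (.hor j) 0 = β at *
  generalize du (.hor (j + 1)) 0 = β' at *
  generalize du (.up j) 0 = η at *
  generalize u (.down j) 0 = α' at *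
  generalize du (.down j) 0 = η' at *
  generalize Complex.exp (θ * Complex.I) = z at *
  generalize Complex.exp (-(θ * Complex.I)) = w at *
  generalize Complex.sin (k * (b / 2 : ℝ)) = s at *
  generalize Complex.cos (k * (b / 2 : ℝ)) = c at *
  generalize Complex.sin (k * a) = sA at *
  generalize Complex.cos (k * a) = cA at *
  generalize Complex.sin (k * b) = sB at *
  generalize Complex.cos (k * b) = cB at *
  field_simp at h1 h3 q1 h6
  -- Each derivative at `x_j` entering the δ-condition is expressed through vertex values,
  -- multiplied by a sine to avoid division: `e1`, `e2` for the two horizontal edges, `e3` for the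
  -- upper and `e5` for the lower edge. Insertion into the δ-condition gives `e7`.
  have e1 : d₁ * sA = k * (cA * p - p₀) := by
    linear_combination sA * h2 - cA * h1 - k * p₀ * hsc
  have e2 : β' * sA = k * (p₁ - cA * p) := by linear_combination -h3
  have e3 : η * sB = k * (z * p - p * cB) := by
    rw [t1, t2]
    linear_combination c * q1 + s * q2 - z * h6
  have e4 : (-k * α' * s + η' * c) * z = -k * p * sB + η * cB := by
    rw [t1, t2]
    linear_combination s * q1 - c * q2
  have e5 : (-k * α' * s + η' * c) * sB = k * (p * cB - w * p) := by
    linear_combination (-(-k * α' * s + η' * c) * sB) * z1 + w * sB * e4 - k * p * w * hscb +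
      w * cB * e3 + k * p * cB * z1
  have e6 : (-d₁ + β' - (-k * α' * s + η' * c) + η) * sA * sB = (γ + g) * p * sA * sB := by
    rw [hd]
  have e7 : k * ((p₁ + p₀ - 2 * cA * p) * sB + sA * p * (2 * Complex.cos θ - 2 * cB)) =
      (γ + g) * p * sA * sB := by
    rw [← e6, ← z2]
    linear_combination sB * e1 - sB * e2 + sA * e5 - sA * e3
  field_simp
  linear_combination e7

/-- A solution whose vertex values vanish is zero. -/
theorem eq_zero_of_vertex_values (ha : 0 < a) (hb : 0 < b) (hk : k ≠ 0)
    (hsa : Complex.sin (k * a) ≠ 0) (hsb : Complex.sin (k * b) ≠ 0) {ψ : CombL2 a b}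
    {u du : Edge → ℝ → ℂ} (h : ∀ e, IsNegSecondDeriv (len a b e) (ψ e) (k ^ 2 • ψ e) (u e) (du e))
    (hv : VertexConditions a b γ γ' θ u du) (h0 : ∀ j, u (.hor j) a = 0) : ψ = 0 := by
  have key : ∀ e, u e 0 = 0 → du e 0 = 0 → ψ e = 0 := by
    intro e h1 h2
    rw [Lp.eq_zero_iff_ae_eq_zero]
    filter_upwards [(h e).ae_eq, ae_restrict_mem measurableSet_Ioo] with t ht hm
    rw [ht, ((h e).eq_trig hk (Set.Ioo_subset_Icc_self hm)).1, h1, h2]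
    simp
  ext1
  funext e
  obtain ⟨z1, -⟩ := exp_mul_I_facts θ
  have hz : Complex.exp (θ * Complex.I) ≠ 0 := Complex.exp_ne_zero _
  obtain ⟨t1, t2⟩ := trig_half k b
  have hup : ∀ j, u (.up j) 0 = 0 ∧ du (.up j) 0 = 0 := by
    intro j
    have h1 : u (.up j) 0 = 0 := by rw [hv.cont_up, h0]
    obtain ⟨h4, h5⟩ := (h (.up j)).eq_trig hk (x := b / 2) ⟨by positivity, le_rfl⟩
    obtain ⟨h6, -⟩ := (h (.down j)).eq_trig hk (x := b / 2) ⟨by positivity, le_rfl⟩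
    rw [hv.cont_down, h0] at h6
    rw [hv.quasi, h1] at h4
    rw [hv.quasi_deriv, h1] at h5
    refine ⟨h1, ?_⟩
    -- Up to the phase, the upper and lower edges join to one interval of length `b` with Dirichlet
    -- conditions at both ends; `sin (k b) ≠ 0` excludes a nonzero solution there.
    have : du (.up j) 0 * Complex.sin (k * b) = 0 := by
      rw [t1]
      field_simp at h4 h6
      linear_combination (-Complex.cos (k * (b / 2 : ℝ))) * h4 -
        Complex.sin (k * (b / 2 : ℝ)) * h5 - Complex.exp (θ * Complex.I) * h6
    exact (mul_eq_zero.1 this).resolve_right hsb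
  rcases e with j | j | j
  · have h1 : u (.hor j) 0 = 0 := by
      have := hv.cont_right (j - 1)
      rwa [sub_add_cancel, h0] at this
    refine key _ h1 ?_
    have h2 := ((h (.hor j)).eq_trig hk (x := a) ⟨ha.le, le_rfl⟩).1
    rw [h0, h1, zero_mul, zero_add] at h2
    exact (mul_eq_zero.1 h2.symm).resolve_right (div_ne_zero hsa hk)
  · exact key _ (hup j).1 (hup j).2
  · obtain ⟨h4, h5⟩ := (h (.up j)).eq_trig hk (x := b / 2) ⟨by positivity, le_rfl⟩
    rw [hv.quasi, (hup j).1, (hup j).2] at h4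
    rw [hv.quasi_deriv, (hup j).1, (hup j).2] at h5
    refine key _ ?_ ?_
    · simpa using h4
    · simpa using h5

/-- The vertex values of a square-integrable solution decay. -/
theorem tendsto_vertex_values (ha : 0 < a) (hk : k ≠ 0) {ψ : CombL2 a b}
    {u du : Edge → ℝ → ℂ} (h : ∀ e, IsNegSecondDeriv (len a b e) (ψ e) (k ^ 2 • ψ e) (u e) (du e))
    (hv : VertexConditions a b γ γ' θ u du) :
    Filter.Tendsto (fun j => u (.hor j) a) Filter.cofinite (nhds 0) := by
  obtain ⟨C, hC⟩ := exists_trace_bound ha hk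
  have hinj : Function.Injective (fun j : ℤ => Edge.hor (j + 1)) := fun i j hij => by
    simpa using hij
  have hs : Summable fun j : ℤ => ‖ψ (.hor (j + 1))‖ ^ (2 : ENNReal).toReal :=
    ((lp.memℓp ψ).summable (by norm_num)).comp_injective hinj
  have ht : Filter.Tendsto (fun j : ℤ => ‖ψ (.hor (j + 1))‖) Filter.cofinite (nhds 0) := by
    have := hs.tendsto_cofinite_zero.rpow_const (p := 1 / 2) (Or.inr (by norm_num))
    simp only [ENNReal.toReal_ofNat, Real.rpow_ofNat, ← Real.sqrt_eq_rpow,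
      Real.sqrt_sq (norm_nonneg _), Real.sqrt_zero] at this
    exact this
  refine squeeze_zero_norm (fun j => ?_) (by simpa using ht.const_mul C)
  -- The value at `x_j` is read off at the start of the following edge, where the trace bound
  -- applies.
  rw [← hv.cont_right]
  exact (hC _ _ _ (h (.hor (j + 1)))).1

end

section

/-! ### Solutions of the inhomogeneous equation on the comb -/

/-- The class of `cos (k x)` on an edge. -/
def cosVec (k : ℂ) (ℓ : ℝ) : EdgeL2 ℓ :=
  (memLp_edge_of_continuousOn (f := fun t : ℝ => Complex.cos (k * t)) (by fun_prop)).toLp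

/-- The class of `sin (k x) / k` on an edge. -/
def sinVec (k : ℂ) (ℓ : ℝ) : EdgeL2 ℓ :=
  (memLp_edge_of_continuousOn (f := fun t : ℝ => Complex.sin (k * t) / k) (by fun_prop)).toLp

/-- The solution operator with zero initial data on an edge. -/
def volterra (k : ℂ) (ℓ : ℝ) : EdgeL2 ℓ →L[ℂ] EdgeL2 ℓ :=
  if h : 0 ≤ ℓ then (exists_volterra_clm h k).choose else 0

/-- The functional `y ↦ ∫ cos (k t) y t` on an edge. -/
def cosInt (k : ℂ) (ℓ : ℝ) : EdgeL2 ℓ →L[ℂ] ℂ :=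
  if h : 0 ≤ ℓ then (exists_primitive_clm (w := fun t : ℝ => Complex.cos (k * t)) (by fun_prop)
    (Set.right_mem_Icc.2 h)).choose else 0

/-- The functional `y ↦ ∫ sin (k t) y t` on an edge. -/
def sinInt (k : ℂ) (ℓ : ℝ) : EdgeL2 ℓ →L[ℂ] ℂ :=
  if h : 0 ≤ ℓ then (exists_primitive_clm (w := fun t : ℝ => Complex.sin (k * t)) (by fun_prop)
    (Set.right_mem_Icc.2 h)).choose else 0

/-- At the level of `L²` classes the solution splits into two fixed vectors weighted by the initial
data plus a bounded operator applied to `y`. In this form the resolvent is visibly continuous in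
each coordinate. -/
theorem coeFn_edgeSol {ℓ : ℝ} (hℓ : 0 ≤ ℓ) (k α β : ℂ) (y : EdgeL2 ℓ) :
    ((α • cosVec k ℓ + β • sinVec k ℓ + volterra k ℓ y : EdgeL2 ℓ) : ℝ → ℂ)
      =ᵐ[volume.restrict (Set.Ioo 0 ℓ)] edgeSol k α β y := by
  have hV : (volterra k ℓ y : ℝ → ℂ) =ᵐ[volume.restrict (Set.Ioo 0 ℓ)] edgeSol k 0 0 y := by
    rw [volterra, dif_pos hℓ]
    exact (exists_volterra_clm hℓ k).choose_spec y
  filter_upwards [Lp.coeFn_add (α • cosVec k ℓ + β • sinVec k ℓ) (volterra k ℓ y),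
    Lp.coeFn_add (α • cosVec k ℓ) (β • sinVec k ℓ), Lp.coeFn_smul α (cosVec k ℓ),
    Lp.coeFn_smul β (sinVec k ℓ), MemLp.coeFn_toLp (memLp_edge_of_continuousOn (ℓ := ℓ)
      (f := fun t : ℝ => Complex.cos (k * t)) (by fun_prop)),
    MemLp.coeFn_toLp (memLp_edge_of_continuousOn (ℓ := ℓ)
      (f := fun t : ℝ => Complex.sin (k * t) / k) (by fun_prop)), hV] with t h1 h2 h3 h4 h5 h6 h7
  have h5' : cosVec k ℓ t = Complex.cos (k * t) := h5
  have h6' : sinVec k ℓ t = Complex.sin (k * t) / k := h6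
  rw [h1, Pi.add_apply, h2, Pi.add_apply, h3, h4, Pi.smul_apply, Pi.smul_apply, h5', h6', h7,
    edgeSol_eq_add k α β, smul_eq_mul, smul_eq_mul]

theorem sinInt_apply {ℓ : ℝ} (hℓ : 0 ≤ ℓ) (k : ℂ) (y : EdgeL2 ℓ) :
    sinInt k ℓ y = ∫ t in (0 : ℝ)..ℓ, Complex.sin (k * t) * y t := by
  rw [sinInt, dif_pos hℓ]
  exact Exists.choose_spec (exists_primitive_clm (w := fun t : ℝ => Complex.sin (k * t))
    (by fun_prop) (Set.right_mem_Icc.2 hℓ)) y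

theorem cosInt_apply {ℓ : ℝ} (hℓ : 0 ≤ ℓ) (k : ℂ) (y : EdgeL2 ℓ) :
    cosInt k ℓ y = ∫ t in (0 : ℝ)..ℓ, Complex.cos (k * t) * y t := by
  rw [cosInt, dif_pos hℓ]
  exact Exists.choose_spec (exists_primitive_clm (w := fun t : ℝ => Complex.cos (k * t))
    (by fun_prop) (Set.right_mem_Icc.2 hℓ)) y

section Amplitudes

-- `M` is `ℂ` for a fixed right-hand side, and the space of continuous functionals on the comb space
-- when the resolvent is assembled; the same formulas then also give continuity of the amplitudes.
variable {M : Type*} [AddCommGroup M] [Module ℂ M]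

/-- The contribution of the right-hand side to the derivative at the start of an upper edge. -/
def loopTerm (b θ : ℝ) (k : ℂ) (S C : Edge → M) (j : ℤ) : M :=
  -((k / Complex.sin (k * b) * Complex.exp (θ * Complex.I)) •
      ((Complex.cos (k * (b / 2 : ℝ)) / k) • S (.down j) -
        (Complex.sin (k * (b / 2 : ℝ)) / k) • C (.down j)) +
    (Complex.cos (k * b) / Complex.sin (k * b)) • S (.up j))

/-- The derivative at the start of an upper edge, up to the contribution of that edge. -/
def loopDeriv (b θ : ℝ) (k : ℂ) (p : ℤ → M) (S C : Edge → M) (j : ℤ) : M :=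
  (k / Complex.sin (k * b) * (Complex.exp (θ * Complex.I) - Complex.cos (k * b))) • p j +
    loopTerm b θ k S C j

/-- The initial values on the edges of the solution with the vertex values `p`. -/
def initValue (b θ : ℝ) (k : ℂ) (p : ℤ → M) (S C : Edge → M) : Edge → M
  | .hor j => p (j - 1)
  | .up j => p j
  | .down j => Complex.exp (-(θ * Complex.I)) •
      (Complex.cos (k * (b / 2 : ℝ)) • (p j + k⁻¹ • S (.up j)) +
        (Complex.sin (k * (b / 2 : ℝ)) / k) • loopDeriv b θ k p S C j)

/-- The initial derivatives on the edges of the solution with the vertex values `p`. -/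
def initDeriv (a b θ : ℝ) (k : ℂ) (p : ℤ → M) (S C : Edge → M) : Edge → M
  | .hor j => (k / Complex.sin (k * a)) •
      (p j - Complex.cos (k * a) • (p (j - 1) + k⁻¹ • S (.hor j))) + C (.hor j)
  | .up j => C (.up j) + loopDeriv b θ k p S C j
  | .down j => Complex.exp (-(θ * Complex.I)) •
      (Complex.cos (k * (b / 2 : ℝ)) • loopDeriv b θ k p S C j -
        (k * Complex.sin (k * (b / 2 : ℝ))) • (p j + k⁻¹ • S (.up j)))

/-- The right-hand side of the difference equation for the vertex values. -/
def vertexSource (a b θ : ℝ) (k : ℂ) (S C : Edge → M) (j : ℤ) : M :=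
  (-(Complex.sin (k * a) / k)) •
    ((Complex.sin (k * a))⁻¹ • S (.hor j) -
      (Complex.cos (k * a) / Complex.sin (k * a)) • S (.hor (j + 1)) + C (.hor (j + 1)) -
      Complex.exp (-(θ * Complex.I)) • (Complex.cos (k * b) • loopTerm b θ k S C j -
        Complex.sin (k * b) • S (.up j)) +
      Complex.sin (k * (b / 2 : ℝ)) • S (.down j) + Complex.cos (k * (b / 2 : ℝ)) • C (.down j) +
      C (.up j) + loopTerm b θ k S C j)

end Amplitudes

variable {a b γ γ' θ : ℝ} {k : ℂ}

theorem len_nonneg (ha : 0 < a) (hb : 0 < b) (e : Edge) : 0 ≤ len a b e := by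
  cases e <;> simp only [len] <;> positivity

/-- The value of a sine functional on the components of an element. -/
abbrev edgeSin (k : ℂ) (y : CombL2 a b) (e : Edge) : ℂ := sinInt k (len a b e) (y e)

/-- The value of a cosine functional on the components of an element. -/
abbrev edgeCos (k : ℂ) (y : CombL2 a b) (e : Edge) : ℂ := cosInt k (len a b e) (y e)

/-- The initial data are chosen so that continuity and the quasi-periodic conditions hold for every
sequence `p`. What remains is the δ-condition, and after elimination it is exactly the inhomogeneous
difference equation `hp`. -/
theorem vertexConditions_edgeSol (hk : k ≠ 0)
    (hsa : Complex.sin (k * a) ≠ 0) (hsb : Complex.sin (k * b) ≠ 0) (f : Edge → ℝ → ℂ)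
    {S C : Edge → ℂ} (hS : ∀ e, S e = ∫ t in (0 : ℝ)..len a b e, Complex.sin (k * t) * f e t)
    (hC : ∀ e, C e = ∫ t in (0 : ℝ)..len a b e, Complex.cos (k * t) * f e t) {p : ℤ → ℂ}
    (hp : ∀ j, p (j + 1) + p (j - 1) - 2 * disc a b γ θ k * p j -
      (if j = 0 then defect a γ γ' k * p 0 else 0) = vertexSource a b θ k S C j) :
    (∀ j, edgeSol k (initValue b θ k p S C (.hor j)) (initDeriv a b θ k p S C (.hor j))
      (f (.hor j)) a = p j) ∧
    VertexConditions a b γ γ' θ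
      (fun e => edgeSol k (initValue b θ k p S C e) (initDeriv a b θ k p S C e) (f e))
      (fun e => edgeSolDeriv k (initValue b θ k p S C e) (initDeriv a b θ k p S C e) (f e)) := by
  have hH : ∀ j, edgeSol k (initValue b θ k p S C (.hor j)) (initDeriv a b θ k p S C (.hor j))
      (f (.hor j)) a = Complex.cos (k * a) * (p (j - 1) + S (.hor j) / k) + Complex.sin (k * a) / k *
        (initDeriv a b θ k p S C (.hor j) - C (.hor j)) ∧
      edgeSolDeriv k (initValue b θ k p S C (.hor j)) (initDeriv a b θ k p S C (.hor j))
      (f (.hor j)) a = -k * Complex.sin (k * a) * (p (j - 1) + S (.hor j) / k) +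
        Complex.cos (k * a) * (initDeriv a b θ k p S C (.hor j) - C (.hor j)) := by
    intro j
    rw [hS, hC]
    exact ⟨rfl, rfl⟩
  have hV : ∀ e, len a b e = b / 2 →
      edgeSol k (initValue b θ k p S C e) (initDeriv a b θ k p S C e)
      (f e) (b / 2) = Complex.cos (k * (b / 2 : ℝ)) * (initValue b θ k p S C e + S e / k) +
        Complex.sin (k * (b / 2 : ℝ)) / k * (initDeriv a b θ k p S C e - C e) ∧
      edgeSolDeriv k (initValue b θ k p S C e) (initDeriv a b θ k p S C e)
      (f e) (b / 2) = -k * Complex.sin (k * (b / 2 : ℝ)) * (initValue b θ k p S C e + S e / k) +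
        Complex.cos (k * (b / 2 : ℝ)) * (initDeriv a b θ k p S C e - C e) := by
    intro e he
    have h1 := hS e
    have h2 := hC e
    rw [he] at h1 h2
    rw [h1, h2]
    exact ⟨rfl, rfl⟩
  have hU := fun j => hV (.up j) rfl
  have hD := fun j => hV (.down j) rfl
  obtain ⟨z1, z2⟩ := exp_mul_I_facts θ
  obtain ⟨t1, t2⟩ := trig_half k b
  have hsc := Complex.sin_sq_add_cos_sq (k * a)
  have hscb := Complex.sin_sq_add_cos_sq (k * b)
  have hends : ∀ j, edgeSol k (initValue b θ k p S C (.hor j)) (initDeriv a b θ k p S C (.hor j))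
      (f (.hor j)) a = p j := by
    intro j
    rw [(hH j).1]
    simp only [initDeriv, smul_eq_mul]
    field_simp
    ring
  refine ⟨hends, ?_⟩
  have hloop : ∀ j, loopDeriv b θ k p S C j * Complex.sin (k * b) =
      k * (Complex.exp (θ * Complex.I) - Complex.cos (k * b)) * p j -
      Complex.exp (θ * Complex.I) * (Complex.cos (k * (b / 2 : ℝ)) * S (.down j) -
        Complex.sin (k * (b / 2 : ℝ)) * C (.down j)) - Complex.cos (k * b) * S (.up j) := by
    intro j
    simp only [loopDeriv, loopTerm, smul_eq_mul]
    field_simp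
    ring
  constructor
  · intro j
    simp only [hends]
    rw [edgeSol_zero, initValue, add_sub_cancel_right]
  · intro j
    simp only [hends]
    rw [edgeSol_zero, initValue]
  · intro j
    simp only [hends]
    rw [(hD j).1]
    have hl := hloop j
    simp only [initValue, initDeriv, smul_eq_mul]
    generalize loopDeriv b θ k p S C j = η at *
    generalize Complex.exp (θ * Complex.I) = z at *
    generalize Complex.exp (-(θ * Complex.I)) = w at *
    generalize Complex.sin (k * (b / 2 : ℝ)) = s at *
    generalize Complex.cos (k * (b / 2 : ℝ)) = c at *
    generalize Complex.sin (k * b) = sB at *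
    generalize Complex.cos (k * b) = cB at *
    subst t1 t2
    field_simp
    linear_combination w * hl + (k * p j - (c * S (.down j) - s * C (.down j))) * z1
  · intro j
    simp only [hends]
    rw [(hH j).2, (hD j).2, edgeSolDeriv_zero, edgeSolDeriv_zero, coupling_mul]
    have hl := hloop j
    have hpj := hp j
    have hl0 : loopTerm b θ k S C j = loopDeriv b θ k p S C j - (k / Complex.sin (k * b) *
      (Complex.exp (θ * Complex.I) - Complex.cos (k * b))) * p j := by
      simp [loopDeriv]
    simp only [initValue, initDeriv, vertexSource, hl0, smul_eq_mul, add_sub_cancel_right] at hpj ⊢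
    have hR : (if j = 0 then defect a γ γ' k * p 0 else 0) =
        (if j = 0 then ((γ' : ℂ) - γ) else 0) * Complex.sin (k * a) / k * p j := by
      split_ifs with hj
      · rw [hj, defect]
      · simp
    rw [hR, disc] at hpj
    generalize (if j = 0 then ((γ' : ℂ) - γ) else 0) = g at hpj ⊢
    generalize loopDeriv b θ k p S C j = η at *
    generalize Complex.exp (θ * Complex.I) = z at *
    generalize Complex.exp (-(θ * Complex.I)) = w at *
    generalize Complex.sin (k * (b / 2 : ℝ)) = s at *
    generalize Complex.cos (k * (b / 2 : ℝ)) = c at *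
    have hcos : Complex.cos θ = (z + w) / 2 := by linear_combination -z2 / 2
    rw [hcos] at hpj
    generalize Complex.sin (k * a) = sA at *
    generalize Complex.cos (k * a) = cA at *
    generalize Complex.sin (k * b) = sB at *
    generalize Complex.cos (k * b) = cB at *
    have e1 : -k * sA * (p (j - 1) + S (.hor j) / k) + cA * (k / sA * (p j - cA *
        (p (j - 1) + k⁻¹ * S (.hor j)))) =
        (k * (cA * p j - p (j - 1)) - S (.hor j)) / sA := by
      field_simp
      linear_combination (-(k * p (j - 1) + S (.hor j))) * hsc
    have e2 : -k * s * (w * (c * (p j + k⁻¹ * S (.up j)) + s / k * η) + S (.down j) / k) +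
        c * (w * (c * η - k * s * (p j + k⁻¹ * S (.up j))) - C (.down j)) =
        w * (cB * η - sB * (k * p j + S (.up j))) - s * S (.down j) - c * C (.down j) := by
      rw [t1, t2]
      field_simp
      ring
    rw [e1, e2]
    clear e1 e2 hl hl0 hU hD hV hH hloop hR hends hp hS hC
    field_simp at hpj
    field_simp
    refine mul_left_cancel₀ hsb ?_
    linear_combination hpj + sA * p j * w * k * hscb - sA * p j * k * cB * z1
  · intro j
    rw [(hU j).1, edgeSol_zero]
    simp only [initValue, initDeriv, smul_eq_mul]
    linear_combination (-(Complex.cos (k * (b / 2 : ℝ)) * (p j + k⁻¹ * S (.up j)) +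
        (Complex.sin (k * (b / 2 : ℝ)) / k) * loopDeriv b θ k p S C j)) * z1
  · intro j
    rw [(hU j).2, edgeSolDeriv_zero]
    simp only [initValue, initDeriv, smul_eq_mul]
    linear_combination (-(Complex.cos (k * (b / 2 : ℝ)) * loopDeriv b θ k p S C j -
        (k * Complex.sin (k * (b / 2 : ℝ))) * (p j + k⁻¹ * S (.up j)))) * z1

end

/-! ### Square-summability of the amplitudes, and the resolvent -/

section

variable {a b γ γ' θ : ℝ} {k : ℂ}

theorem memℓp_edge {E : Edge → Type*} [∀ e, NormedAddCommGroup (E e)] {f : ∀ e, E e}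
    (h₁ : Memℓp (fun j => f (.hor j)) 2) (h₂ : Memℓp (fun j => f (.up j)) 2)
    (h₃ : Memℓp (fun j => f (.down j)) 2) : Memℓp f 2 := by
  rw [memℓp_gen_iff (by norm_num)] at h₁ h₂ h₃ ⊢
  let φ : ℤ ⊕ ℤ ⊕ ℤ ≃ Edge :=
    { toFun := Sum.elim .hor (Sum.elim .up .down)
      invFun := fun e => match e with
        | .hor j => .inl j
        | .up j => .inr (.inl j)
        | .down j => .inr (.inr j)
      left_inv := by rintro (j | j | j) <;> rfl
      right_inv := by rintro (j | j | j) <;> rfl }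
  rw [← φ.summable_iff]
  exact Summable.sum _ h₁ (Summable.sum _ h₂ h₃)

/-- The solution on the comb with the vertex values `p`. -/
def combSol (θ : ℝ) (k : ℂ) (p : ℤ → ℂ) (y : CombL2 a b) (e : Edge) : EdgeL2 (len a b e) :=
  initValue b θ k p (edgeSin k y) (edgeCos k y) e • cosVec k (len a b e) +
    initDeriv a b θ k p (edgeSin k y) (edgeCos k y) e • sinVec k (len a b e) +
    volterra k (len a b e) (y e)

theorem memℓp_edge_functionals (k : ℂ) (y : CombL2 a b) :
    (Memℓp (fun j => edgeSin k y (.hor j)) 2 ∧ Memℓp (fun j => edgeSin k y (.up j)) 2 ∧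
      Memℓp (fun j => edgeSin k y (.down j)) 2) ∧
    (Memℓp (fun j => edgeCos k y (.hor j)) 2 ∧ Memℓp (fun j => edgeCos k y (.up j)) 2 ∧
      Memℓp (fun j => edgeCos k y (.down j)) 2) := by
  have h1 : Memℓp (E := fun _ : ℤ => EdgeL2 a) (fun j => y (.hor j)) 2 :=
    memℓp_comp_injective (lp.memℓp y) fun i j h => by simpa using h
  have h2 : Memℓp (E := fun _ : ℤ => EdgeL2 (b / 2)) (fun j => y (.up j)) 2 :=
    memℓp_comp_injective (lp.memℓp y) fun i j h => by simpa using h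
  have h3 : Memℓp (E := fun _ : ℤ => EdgeL2 (b / 2)) (fun j => y (.down j)) 2 :=
    memℓp_comp_injective (lp.memℓp y) fun i j h => by simpa using h
  exact ⟨⟨memℓp_clm (sinInt k a) h1, memℓp_clm (sinInt k (b / 2)) h2,
    memℓp_clm (sinInt k (b / 2)) h3⟩, memℓp_clm (cosInt k a) h1, memℓp_clm (cosInt k (b / 2)) h2,
    memℓp_clm (cosInt k (b / 2)) h3⟩

theorem memℓp_fun_add {ι E : Type*} [NormedAddCommGroup E] {f g : ι → E} (hf : Memℓp f 2)
    (hg : Memℓp g 2) : Memℓp (fun i => f i + g i) 2 := hf.add hg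

theorem memℓp_fun_sub {ι E : Type*} [NormedAddCommGroup E] {f g : ι → E} (hf : Memℓp f 2)
    (hg : Memℓp g 2) : Memℓp (fun i => f i - g i) 2 := hf.sub hg

theorem memℓp_fun_neg {ι E : Type*} [NormedAddCommGroup E] {f : ι → E} (hf : Memℓp f 2) :
    Memℓp (fun i => -f i) 2 := hf.neg

theorem memℓp_fun_smul {ι E : Type*} [NormedAddCommGroup E] [NormedSpace ℂ E] {f : ι → E}
    (hf : Memℓp f 2) (c : ℂ) : Memℓp (fun i => c • f i) 2 := hf.const_smul c

section

variable {S C : Edge → ℂ} {p : ℤ → ℂ}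

theorem memℓp_loopTerm (s2 : Memℓp (fun j => S (.up j)) 2) (s3 : Memℓp (fun j => S (.down j)) 2)
    (c3 : Memℓp (fun j => C (.down j)) 2) : Memℓp (fun j => loopTerm b θ k S C j) 2 := by
  simp only [loopTerm]
  repeat' (first
    | with_reducible refine memℓp_fun_add ?_ ?_
    | with_reducible refine memℓp_fun_sub ?_ ?_
    | with_reducible refine memℓp_fun_neg ?_
    | with_reducible refine memℓp_fun_smul ?_ _
    | with_reducible assumption)

theorem memℓp_vertexSource (s1 : Memℓp (fun j => S (.hor j)) 2)
    (s2 : Memℓp (fun j => S (.up j)) 2) (s3 : Memℓp (fun j => S (.down j)) 2)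
    (c1 : Memℓp (fun j => C (.hor j)) 2) (c2 : Memℓp (fun j => C (.up j)) 2)
    (c3 : Memℓp (fun j => C (.down j)) 2) : Memℓp (fun j => vertexSource a b θ k S C j) 2 := by
  have hl := memℓp_loopTerm (b := b) (θ := θ) (k := k) s2 s3 c3
  have s1' : Memℓp (fun j => S (.hor (j + 1))) 2 :=
    memℓp_comp_injective s1 (add_left_injective (1 : ℤ))
  have c1' : Memℓp (fun j => C (.hor (j + 1))) 2 :=
    memℓp_comp_injective c1 (add_left_injective (1 : ℤ))
  simp only [vertexSource]
  repeat' (first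
    | with_reducible refine memℓp_fun_add ?_ ?_
    | with_reducible refine memℓp_fun_sub ?_ ?_
    | with_reducible refine memℓp_fun_neg ?_
    | with_reducible refine memℓp_fun_smul ?_ _
    | with_reducible assumption)

theorem memℓp_initial_data (hp : Memℓp (fun j => p j) 2) (s1 : Memℓp (fun j => S (.hor j)) 2)
    (s2 : Memℓp (fun j => S (.up j)) 2) (s3 : Memℓp (fun j => S (.down j)) 2)
    (c1 : Memℓp (fun j => C (.hor j)) 2) (c2 : Memℓp (fun j => C (.up j)) 2)
    (c3 : Memℓp (fun j => C (.down j)) 2) :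
    Memℓp (initValue b θ k p S C) 2 ∧ Memℓp (initDeriv a b θ k p S C) 2 := by
  have hl0 := memℓp_loopTerm (b := b) (θ := θ) (k := k) s2 s3 c3
  have hl : Memℓp (fun j => loopDeriv b θ k p S C j) 2 := by
    simp only [loopDeriv]
    repeat' (first
      | with_reducible refine memℓp_fun_add ?_ ?_
      | with_reducible refine memℓp_fun_sub ?_ ?_
      | with_reducible refine memℓp_fun_neg ?_
      | with_reducible refine memℓp_fun_smul ?_ _
      | with_reducible assumption)
  have hp' : Memℓp (fun j => p (j - 1)) 2 := memℓp_comp_injective hp sub_left_injective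
  constructor <;> refine memℓp_edge ?_ ?_ ?_ <;> simp only [initValue, initDeriv]
  repeat' (first
    | with_reducible refine memℓp_fun_add ?_ ?_
    | with_reducible refine memℓp_fun_sub ?_ ?_
    | with_reducible refine memℓp_fun_neg ?_
    | with_reducible refine memℓp_fun_smul ?_ _
    | with_reducible assumption)

end

theorem memℓp_smul_vec {ι : Type*} {E : ι → Type*} [∀ i, NormedAddCommGroup (E i)]
    [∀ i, NormedSpace ℂ (E i)] {f : ι → ℂ} (hf : Memℓp f 2) (v : ∀ i, E i) {C : ℝ}
    (hC : ∀ i, ‖v i‖ ≤ C) : Memℓp (fun i => f i • v i) 2 :=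
  (hf.norm.const_mul C).mono fun i => by
    rw [norm_smul, mul_comm]
    exact mul_le_mul_of_nonneg_right (hC i) (norm_nonneg _)

theorem exists_len_bound (a b : ℝ) (F : ℝ → ℝ) : ∃ C, ∀ e, F (len a b e) ≤ C :=
  ⟨max (F a) (F (b / 2)), fun e => by cases e <;> simp [len]⟩

theorem memℓp_combSol {p : ℤ → ℂ} (hp : Memℓp p 2) (y : CombL2 a b) :
    Memℓp (combSol θ k p y) 2 := by
  obtain ⟨⟨s1, s2, s3⟩, c1, c2, c3⟩ := memℓp_edge_functionals k y
  obtain ⟨hα, hβ⟩ := memℓp_initial_data (a := a) (b := b) (θ := θ) (k := k) hp s1 s2 s3 c1 c2 c3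
  obtain ⟨C₁, h₁⟩ := exists_len_bound a b fun ℓ => ‖cosVec k ℓ‖
  obtain ⟨C₂, h₂⟩ := exists_len_bound a b fun ℓ => ‖sinVec k ℓ‖
  obtain ⟨C₃, h₃⟩ := exists_len_bound a b fun ℓ => ‖volterra k ℓ‖
  have h3 : Memℓp (fun e => volterra k (len a b e) (y e)) 2 :=
    ((lp.memℓp y).norm.const_mul C₃).mono fun e =>
      ((volterra k (len a b e)).le_opNorm (y e)).trans
        (mul_le_mul_of_nonneg_right (h₃ e) (norm_nonneg _))
  exact ((memℓp_smul_vec hα _ h₁).add (memℓp_smul_vec hβ _ h₂)).add h3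

/-- The functions with the given vertex values solve the inhomogeneous equation. -/
theorem combSol_mem_fiberGraph (ha : 0 < a) (hb : 0 < b) (hk : k ≠ 0)
    (hsa : Complex.sin (k * a) ≠ 0) (hsb : Complex.sin (k * b) ≠ 0) (y ψ : CombL2 a b)
    {p : ℤ → ℂ} (hp : ∀ j, p (j + 1) + p (j - 1) - 2 * disc a b γ θ k * p j -
      (if j = 0 then defect a γ γ' k * p 0 else 0) =
        vertexSource a b θ k (edgeSin k y) (edgeCos k y) j)
    (hψ : ∀ e, ψ e = combSol θ k p y e) :
    ∃ u du : Edge → ℝ → ℂ, (∀ e, IsNegSecondDeriv (len a b e) (ψ e) (y e + k ^ 2 • ψ e)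
      (u e) (du e)) ∧ VertexConditions a b γ γ' θ u du ∧ ∀ j, u (.hor j) a = p j := by
  obtain ⟨h1, h2⟩ := vertexConditions_edgeSol (γ := γ) (γ' := γ') hk hsa hsb (fun e => y e)
    (S := edgeSin k y) (C := edgeCos k y)
    (fun e => sinInt_apply (len_nonneg ha hb e) k (y e))
    (fun e => cosInt_apply (len_nonneg ha hb e) k (y e)) hp
  refine ⟨_, _, fun e => ?_, h2, h1⟩
  refine isNegSecondDeriv_edgeSol hk (y e) (ψ e) ?_
  rw [hψ]
  exact coeFn_edgeSol (len_nonneg ha hb e) k _ _ (y e)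

theorem mem_fiberOp_graph {x y : CombL2 a b} :
    (x, y) ∈ fiberGraph a b γ γ' θ ↔
      ∃ h : x ∈ (fiberOp a b γ γ' θ).domain, fiberOp a b γ γ' θ ⟨x, h⟩ = y := by
  rw [← fiberOp_graph, LinearPMap.mem_graph_iff]
  constructor
  · rintro ⟨z, rfl, h⟩
    exact ⟨z.2, h⟩
  · rintro ⟨h, h'⟩
    exact ⟨⟨x, h⟩, rfl, h'⟩

/-- The vertex values of an eigenfunction are geometric, and they satisfy the condition at the
defect. -/
theorem eigenfunction_vertex_values (ha : 0 < a) (hb : 0 < b) (hk : k ≠ 0)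
    (hsb : Complex.sin (k * b) ≠ 0) {μ : ℂ} (hμ0 : μ ≠ 0) (hμ : ‖μ‖ ≤ 1)
    (hF : μ + μ⁻¹ = 2 * disc a b γ θ k) {ψ : CombL2 a b} {u du : Edge → ℝ → ℂ}
    (h : ∀ e, IsNegSecondDeriv (len a b e) (ψ e) (k ^ 2 • ψ e) (u e) (du e))
    (hv : VertexConditions a b γ γ' θ u du) :
    (∀ j, u (.hor j) a = μ ^ j.natAbs * u (.hor 0) a) ∧
      (μ - μ⁻¹ - defect a γ γ' k) * u (.hor 0) a = 0 :=
  defect_recursion hμ0 hμ hF (p := fun j => u (.hor j) a)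
    (fun j => vertex_recursion ha hb hk hsb h hv j) (tendsto_vertex_values ha hk h hv)

/-- The resolvent solves the lattice equation with source `vertexSource` by means of `Q` and fills
in the edges by variation of constants. Its coordinates are continuous and the result is
square-summable, so it is bounded. -/
theorem mem_resolventSet (ha : 0 < a) (hb : 0 < b) (hk : k ≠ 0)
    (hsa : Complex.sin (k * a) ≠ 0) (hsb : Complex.sin (k * b) ≠ 0) {μ : ℂ} (hμ0 : μ ≠ 0)
    (hμ : ‖μ‖ < 1) (hF : μ + μ⁻¹ = 2 * disc a b γ θ k)
    (hs : μ - μ⁻¹ - defect a γ γ' k ≠ 0) :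
    k ^ 2 ∈ resolventSet (fiberOp a b γ γ' θ) := by
  obtain ⟨Q, hQ⟩ := exists_lattice_inverse hμ0 hμ hF hs
  let S : Edge → (CombL2 a b →L[ℂ] ℂ) := fun e =>
    sinInt k (len a b e) ∘L lp.evalCLM ℂ (fun e => EdgeL2 (len a b e)) 2 e
  let C : Edge → (CombL2 a b →L[ℂ] ℂ) := fun e =>
    cosInt k (len a b e) ∘L lp.evalCLM ℂ (fun e => EdgeL2 (len a b e)) 2 e
  obtain ⟨W, hW⟩ := exists_clm_lp (p := 2) (E := fun _ : ℤ => ℂ)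
    (fun j => vertexSource a b θ k S C j) (fun y => by
      obtain ⟨⟨s1, s2, s3⟩, c1, c2, c3⟩ := memℓp_edge_functionals k y
      exact memℓp_vertexSource (S := edgeSin k y) (C := edgeCos k y) s1 s2 s3 c1 c2 c3)
  have hW' : ∀ y j, W y j = vertexSource a b θ k (edgeSin k y) (edgeCos k y) j := hW
  let P : ℤ → (CombL2 a b →L[ℂ] ℂ) := fun j =>
    lp.evalCLM ℂ (fun _ : ℤ => ℂ) 2 j ∘L Q ∘L W
  let T : ∀ e, CombL2 a b →L[ℂ] EdgeL2 (len a b e) := fun e =>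
    (initValue b θ k P S C e).smulRight (cosVec k (len a b e)) +
      (initDeriv a b θ k P S C e).smulRight (sinVec k (len a b e)) +
      volterra k (len a b e) ∘L lp.evalCLM ℂ (fun e => EdgeL2 (len a b e)) 2 e
  have hT : ∀ y e, T e y = combSol θ k (Q (W y)) y e := by
    intro y e
    cases e <;> rfl
  obtain ⟨R, hR⟩ := exists_clm_lp (p := 2) T fun y => by
    simp only [hT]
    exact memℓp_combSol (lp.memℓp (Q (W y))) y
  have hgraph : ∀ y, (R y, y + k ^ 2 • R y) ∈ fiberGraph a b γ γ' θ := by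
    intro y
    obtain ⟨u, du, h1, h2, -⟩ := combSol_mem_fiberGraph (γ := γ) (γ' := γ') (θ := θ) ha hb hk hsa hsb
      y (R y) (p := Q (W y)) (fun j => by rw [hQ, hW']) (fun e => by rw [hR, hT])
    exact ⟨u, du, h1, h2⟩
  have hsol : ∀ y, ∃ h : R y ∈ (fiberOp a b γ γ' θ).domain,
      fiberOp a b γ γ' θ ⟨R y, h⟩ - k ^ 2 • R y = y := by
    intro y
    obtain ⟨h, h'⟩ := mem_fiberOp_graph.1 (hgraph y)
    exact ⟨h, by rw [h', add_sub_cancel_right]⟩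
  refine ⟨R, hsol, fun x => ?_⟩
  have hx : ((x : CombL2 a b), fiberOp a b γ γ' θ x) ∈ fiberGraph a b γ γ' θ :=
    mem_fiberOp_graph.2 ⟨x.2, rfl⟩
  -- For the left inverse, `R (A - k²) x - x` solves the homogeneous equation. Its vertex values are
  -- geometric, and `hs` forces the value at the origin, hence all of them, to vanish.
  have hd := (fiberGraph a b γ γ' θ).sub_mem
    (hgraph (fiberOp a b γ γ' θ x - k ^ 2 • (x : CombL2 a b))) hx
  set w := R (fiberOp a b γ γ' θ x - k ^ 2 • (x : CombL2 a b)) - x with hw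
  have heq : (R (fiberOp a b γ γ' θ x - k ^ 2 • (x : CombL2 a b)),
      fiberOp a b γ γ' θ x - k ^ 2 • (x : CombL2 a b) +
        k ^ 2 • R (fiberOp a b γ γ' θ x - k ^ 2 • (x : CombL2 a b))) -
      ((x : CombL2 a b), fiberOp a b γ γ' θ x) = (w, k ^ 2 • w) := by
    rw [Prod.mk_sub_mk, hw, smul_sub]
    congr 1
    abel
  rw [heq] at hd
  obtain ⟨u, du, h1, h2⟩ := hd
  obtain ⟨h3, h4⟩ := eigenfunction_vertex_values ha hb hk hsb hμ0 hμ.le hF h1 h2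
  have h5 := (mul_eq_zero.1 h4).resolve_left hs
  have h6 : w = 0 := eq_zero_of_vertex_values ha hb hk hsa hsb h1 h2 fun j => by
    rw [h3, h5, mul_zero]
  exact sub_eq_zero.1 h6

end

section

variable {a b γ γ' θ : ℝ}

/-! ### Energies in the discrete spectrum -/

/-- The roots `F ± w` of `μ² - 2 F μ + 1` have product 1, so one of them lies in the closed unit
disc. -/
theorem exists_joukowsky (F : ℂ) : ∃ μ : ℂ, μ ≠ 0 ∧ ‖μ‖ ≤ 1 ∧ μ + μ⁻¹ = 2 * F := by
  obtain ⟨w, hw⟩ := IsAlgClosed.exists_pow_nat_eq (F ^ 2 - 1) (n := 2) (by norm_num)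
  have hprod : (F + w) * (F - w) = 1 := by linear_combination -hw
  have h1 : F + w ≠ 0 := left_ne_zero_of_mul_eq_one hprod
  have h2 : F - w ≠ 0 := right_ne_zero_of_mul_eq_one hprod
  have i1 : (F + w)⁻¹ = F - w := inv_eq_of_mul_eq_one_right hprod
  have i2 : (F - w)⁻¹ = F + w := inv_eq_of_mul_eq_one_left hprod
  by_cases h : ‖F + w‖ ≤ 1
  · exact ⟨F + w, h1, h, by rw [i1]; ring⟩
  · refine ⟨F - w, h2, ?_, by rw [i2]; ring⟩
    have hn := congrArg norm hprod
    rw [norm_mul, norm_one] at hn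
    push Not at h
    nlinarith [norm_nonneg (F - w)]

/-- On the unit circle `μ + μ⁻¹ = 2 Re μ`, which would put `F` in `[-1, 1]`. -/
theorem norm_lt_one_of_joukowsky {μ F : ℂ} (h : ‖μ‖ ≤ 1) (hF : μ + μ⁻¹ = 2 * F)
    (hout : F.im ≠ 0 ∨ 1 < |F.re|) : ‖μ‖ < 1 := by
  refine lt_of_le_of_ne h fun h1 => ?_
  rw [Complex.inv_eq_conj h1, Complex.add_conj] at hF
  have hF' : F = (μ.re : ℂ) := by
    push_cast at hF
    linear_combination -hF / 2
  rw [hF'] at hout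
  rcases hout with h2 | h2
  · exact h2 (Complex.ofReal_im _)
  · rw [Complex.ofReal_re] at h2
    exact absurd (h1 ▸ Complex.abs_re_le_norm μ) (not_le.2 h2)

/-- `disc` for real wave numbers. -/
def realDisc (a b γ θ k : ℝ) : ℝ :=
  Real.cos (k * a) + Real.sin (k * a) / Real.sin (k * b) *
    (Real.cos (k * b) - Real.cos θ) + γ * Real.sin (k * a) / (2 * k)

/-- `defect` for real wave numbers. -/
def realDefect (a γ γ' k : ℝ) : ℝ := (γ' - γ) * Real.sin (k * a) / k

theorem disc_ofReal (a b γ θ k : ℝ) : disc a b γ θ (k : ℂ) = (realDisc a b γ θ k : ℂ) := by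
  simp [disc, realDisc]

theorem defect_ofReal (a γ γ' k : ℝ) : defect a γ γ' (k : ℂ) = (realDefect a γ γ' k : ℂ) := by
  simp [defect, realDefect]

theorem sin_ofReal_ne_zero {k a : ℝ} (h : Real.sin (k * a) ≠ 0) :
    Complex.sin ((k : ℂ) * a) ≠ 0 := by
  rw [← Complex.ofReal_mul, ← Complex.ofReal_sin]
  exact_mod_cast h

theorem mem_eigenspace_fiberOp {x : (fiberOp a b γ γ' θ).domain} {z : ℂ} :
    x ∈ eigenspace (fiberOp a b γ γ' θ) z ↔
      ((x : CombL2 a b), z • (x : CombL2 a b)) ∈ fiberGraph a b γ γ' θ := by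
  have h : x ∈ eigenspace (fiberOp a b γ γ' θ) z ↔
      fiberOp a b γ γ' θ x = z • (x : CombL2 a b) := by
    rw [eigenspace, LinearMap.mem_ker]
    exact sub_eq_zero
  rw [h, mem_fiberOp_graph]
  exact ⟨fun h => ⟨x.2, h⟩, fun ⟨_, h⟩ => h⟩

/-- The condition satisfied by the eigenvalues. -/
theorem dispersion_of_eigenvalue (ha : 0 < a) (hb : 0 < b) {k : ℝ} (hk : 0 < k)
    (hγ : γ' ≠ γ) (hsa : Real.sin (k * a) ≠ 0) (hsb : Real.sin (k * b) ≠ 0)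
    (h : eigenspace (fiberOp a b γ γ' θ) ((k ^ 2 : ℝ) : ℂ) ≠ ⊥) :
    realDisc a b γ θ k ^ 2 = 1 + realDefect a γ γ' k ^ 2 / 4 ∧
      realDisc a b γ θ k * realDefect a γ γ' k < 0 := by
  obtain ⟨x, hx, hx0⟩ := (Submodule.ne_bot_iff _).1 h
  rw [mem_eigenspace_fiberOp, Complex.ofReal_pow] at hx
  obtain ⟨u, du, h1, h2⟩ := hx
  have hkc : (k : ℂ) ≠ 0 := by exact_mod_cast hk.ne'
  obtain ⟨μ, hμ0, hμ, hF⟩ := exists_joukowsky (disc a b γ θ k)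
  obtain ⟨h3, h4⟩ := eigenfunction_vertex_values ha hb hkc (sin_ofReal_ne_zero hsb) hμ0 hμ hF h1 h2
  have hu : u (.hor 0) a ≠ 0 := by
    intro h0
    refine hx0 (Subtype.ext ?_)
    exact eq_zero_of_vertex_values ha hb hkc (sin_ofReal_ne_zero hsa) (sin_ofReal_ne_zero hsb)
      h1 h2 fun j => by rw [h3, h0, mul_zero]
  have hD := (mul_eq_zero.1 h4).resolve_right hu
  rw [disc_ofReal] at hF
  rw [defect_ofReal] at hD
  have hs0 : realDefect a γ γ' k ≠ 0 :=
    div_ne_zero (mul_ne_zero (sub_ne_zero.2 hγ) hsa) hk.ne'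
  set F := realDisc a b γ θ k
  set s := realDefect a γ γ' k
  -- Adding and subtracting the two relations gives `μ` and `μ⁻¹` as `F ± s/2`. Their product being
  -- 1 is the dispersion relation, and `‖μ‖ ≤ 1` then gives `F s ≤ -s²/2 < 0`.
  have e1 : μ = ((F + s / 2 : ℝ) : ℂ) := by push_cast; linear_combination (hF + hD) / 2
  have e2 : μ⁻¹ = ((F - s / 2 : ℝ) : ℂ) := by push_cast; linear_combination (hF - hD) / 2
  have e3 : (F + s / 2) * (F - s / 2) = 1 := by
    have := mul_inv_cancel₀ hμ0
    rw [e2, e1] at this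
    exact_mod_cast this
  rw [e1, Complex.norm_real, Real.norm_eq_abs] at hμ
  have hsq : (F + s / 2) ^ 2 ≤ 1 := by rw [← sq_abs]; exact pow_le_one₀ (abs_nonneg _) hμ
  have hs2 : 0 < s ^ 2 := by positivity
  constructor <;> nlinarith

/-- An entire function vanishing at the exceptional wave numbers. -/
def charFun (a b γ γ' θ : ℝ) (w : ℂ) : ℂ :=
  (w * Complex.cos (w * a) * Complex.sin (w * b) +
    w * Complex.sin (w * a) * (Complex.cos (w * b) - Complex.cos θ) +
    γ / 2 * Complex.sin (w * a) * Complex.sin (w * b)) ^ 2 -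
  ((γ' - γ) / 2 * Complex.sin (w * a) * Complex.sin (w * b)) ^ 2 - (w * Complex.sin (w * b)) ^ 2

theorem charFun_eq {w : ℂ} (hw : w ≠ 0) (hs : Complex.sin (w * b) ≠ 0) :
    charFun a b γ γ' θ w = (disc a b γ θ w ^ 2 - defect a γ γ' w ^ 2 / 4 - 1) *
      (w * Complex.sin (w * b)) ^ 2 := by
  rw [charFun, disc, defect]
  field_simp
  ring

theorem differentiable_charFun : Differentiable ℂ (charFun a b γ γ' θ) := by
  unfold charFun
  fun_prop

/-- Far up the imaginary axis the sines and cosines become hyperbolic, and `κ cosh (κ a) sinh (κ b)`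
outgrows the coupling terms. One nonzero value keeps the entire function `charFun` from vanishing
identically. -/
theorem exists_charFun_ne_zero (ha : 0 < a) (hb : 0 < b) : ∃ w, charFun a b γ γ' θ w ≠ 0 := by
  set M := (|γ| + |γ' - γ|) / 2 with hM
  have hM0 : 0 ≤ M := by positivity
  -- The summand `3 / a` makes `exp (κ a) ≥ 4`, hence `cosh - 1 ≥ sinh / 2` at `κ a`; the summand `2
  -- M + 1` makes `κ / 2 > M`, contradicting the bound reached at the end.
  set κ := 2 * M + 1 + 3 / a with hκ
  have h3a : 0 < 3 / a := by positivity
  have hκ0 : 0 < κ := by positivity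
  refine ⟨κ * Complex.I, fun h0 => ?_⟩
  have hmul : ∀ c : ℝ, (κ : ℂ) * Complex.I * c = (κ * c : ℝ) * Complex.I := fun c => by
    push_cast; ring
  rw [charFun, hmul, hmul, Complex.cos_mul_I, Complex.cos_mul_I, Complex.sin_mul_I,
    Complex.sin_mul_I] at h0
  set A := Real.sinh (κ * a) with hA
  set B := Real.sinh (κ * b) with hB
  set cA := Real.cosh (κ * a) with hcA
  set cB := Real.cosh (κ * b) with hcB
  have hreal : (κ * (cA * B + A * (cB - Real.cos θ)) + γ / 2 * A * B) ^ 2 =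
      ((γ' - γ) / 2 * A * B) ^ 2 + (κ * B) ^ 2 := by
    have : (((κ * (cA * B + A * (cB - Real.cos θ)) + γ / 2 * A * B) ^ 2 : ℝ) : ℂ) =
        ((((γ' - γ) / 2 * A * B) ^ 2 + (κ * B) ^ 2 : ℝ) : ℂ) := by
      simp only [hA, hB, hcA, hcB]
      push_cast at h0 ⊢
      have hI4 : Complex.I ^ 4 = 1 := Complex.I_pow_four
      ring_nf at h0 ⊢
      simp only [hI4] at h0
      linear_combination h0
    exact_mod_cast this
  have hA0 : 0 < A := Real.sinh_pos_iff.2 (by positivity)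
  have hB0 : 0 < B := Real.sinh_pos_iff.2 (by positivity)
  have hcB1 : 1 ≤ cB := Real.one_le_cosh _
  have hle : κ * (cA * B + A * (cB - Real.cos θ)) + γ / 2 * A * B ≤
      (|γ' - γ| / 2 * A + κ) * B := by
    refine le_of_sq_le_sq ?_ (by positivity)
    rw [hreal]
    have h1 : ((γ' - γ) / 2 * A * B) ^ 2 = (|γ' - γ| / 2 * A * B) ^ 2 := by
      rw [mul_pow, mul_pow, div_pow, mul_pow _ B, mul_pow _ A, div_pow, sq_abs]
    rw [h1]
    have : 0 ≤ |γ' - γ| / 2 * A * B * (κ * B) := by positivity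
    nlinarith
  have hexp : 4 ≤ Real.exp (κ * a) := by
    have h1 := Real.add_one_le_exp (κ * a)
    have h2 : 3 ≤ κ * a := by
      have : 3 = 3 / a * a := by field_simp
      rw [this, hκ]
      gcongr
      linarith
    linarith
  have hcosh : A / 2 ≤ cA - 1 := by
    rw [hA, hcA, Real.sinh_eq, Real.cosh_eq]
    have := Real.exp_pos (-(κ * a))
    linarith
  have hγ1 : -|γ| ≤ γ := neg_abs_le γ
  have hAB : 0 < A * B := by positivity
  have t1 : 0 ≤ κ * (A * (cB - Real.cos θ)) := by
    have := Real.cos_le_one θ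
    have : 0 ≤ cB - Real.cos θ := by linarith
    positivity
  have t2 : κ * B * (A / 2) ≤ κ * B * (cA - 1) := by gcongr
  have t3 : -|γ| / 2 * (A * B) ≤ γ / 2 * (A * B) := by gcongr
  have t4 : κ / 2 * (A * B) ≤ M * (A * B) := by
    rw [hM]
    linarith
  have t5 := le_of_mul_le_mul_right t4 hAB
  linarith

/-- All hypotheses of `mem_resolventSet` but one are open near `k`; in particular `|Re disc| > 1`
forces `‖μ‖ < 1`. The remaining one, on the defect, can fail only at zeros of `charFun`, and these
are isolated. -/
theorem eventually_mem_resolventSet (ha : 0 < a) (hb : 0 < b) {k : ℝ} (hk : 0 < k)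
    (hsa : Real.sin (k * a) ≠ 0) (hsb : Real.sin (k * b) ≠ 0)
    (hF : 1 < |realDisc a b γ θ k|) :
    ∀ᶠ w in nhdsWithin (k : ℂ) {(k : ℂ)}ᶜ, w ^ 2 ∈ resolventSet (fiberOp a b γ γ' θ) := by
  have hkc : (k : ℂ) ≠ 0 := by exact_mod_cast hk.ne'
  have hsa' := sin_ofReal_ne_zero hsa
  have hsb' := sin_ofReal_ne_zero hsb
  have e1 : ∀ᶠ w : ℂ in nhds (k : ℂ), w ≠ 0 := isOpen_ne.mem_nhds hkc
  have e2 : ∀ᶠ w : ℂ in nhds (k : ℂ), Complex.sin (w * a) ≠ 0 :=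
    ContinuousAt.eventually_ne (by fun_prop) hsa'
  have e3 : ∀ᶠ w : ℂ in nhds (k : ℂ), Complex.sin (w * b) ≠ 0 :=
    ContinuousAt.eventually_ne (by fun_prop) hsb'
  have hdc : ContinuousAt (disc a b γ θ) (k : ℂ) := by
    unfold disc
    fun_prop (disch := simp [*])
  have e4 : ∀ᶠ w : ℂ in nhds (k : ℂ), 1 < |(disc a b γ θ w).re| := by
    have hc : ContinuousAt (fun w => |(disc a b γ θ w).re|) (k : ℂ) :=
      (Complex.continuous_re.continuousAt.comp hdc).abs
    refine hc.eventually_const_lt ?_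
    beta_reduce
    rw [disc_ofReal, Complex.ofReal_re]
    exact hF
  have e5 : ∀ᶠ w in nhdsWithin (k : ℂ) {(k : ℂ)}ᶜ, charFun a b γ γ' θ w ≠ 0 := by
    have hA : AnalyticOnNhd ℂ (charFun a b γ γ' θ) Set.univ :=
      differentiable_charFun.differentiableOn.analyticOnNhd isOpen_univ
    refine (hA (k : ℂ) trivial).eventually_eq_zero_or_eventually_ne_zero.resolve_left fun h0 => ?_
    obtain ⟨w, hw⟩ := exists_charFun_ne_zero (γ := γ) (γ' := γ') (θ := θ) ha hb
    exact hw (hA.eqOn_zero_of_preconnected_of_eventuallyEq_zero isPreconnected_univ trivial h0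
      (Set.mem_univ w))
  filter_upwards [e5, e1.filter_mono nhdsWithin_le_nhds, e2.filter_mono nhdsWithin_le_nhds,
    e3.filter_mono nhdsWithin_le_nhds, e4.filter_mono nhdsWithin_le_nhds] with w h5 h1 h2 h3 h4
  obtain ⟨μ, hμ0, hμ, hμF⟩ := exists_joukowsky (disc a b γ θ w)
  refine mem_resolventSet ha hb h1 h2 h3 hμ0 (norm_lt_one_of_joukowsky hμ hμF (Or.inr h4)) hμF ?_
  intro hD
  apply h5
  rw [charFun_eq h1 h3]
  have hinv := mul_inv_cancel₀ hμ0
  have : disc a b γ θ w ^ 2 - defect a γ γ' w ^ 2 / 4 - 1 = 0 := by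
    have hd : defect a γ γ' w = μ - μ⁻¹ := by linear_combination -hD
    have hd2 : disc a b γ θ w = (μ + μ⁻¹) / 2 := by linear_combination -hμF / 2
    rw [hd, hd2]
    linear_combination hinv
  rw [this, zero_mul]

/-- The vertex values `μ ^ |j|` with `μ = F + s/2` produce an eigenfunction. Isolation comes from
`eventually_mem_resolventSet`, and finite multiplicity from the fact that one vertex value
determines an eigenfunction. -/
theorem mem_discreteSpectrum (ha : 0 < a) (hb : 0 < b) {k : ℝ} (hk : 0 < k)
    (hsa : Real.sin (k * a) ≠ 0) (hsb : Real.sin (k * b) ≠ 0)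
    (h1 : realDisc a b γ θ k ^ 2 = 1 + realDefect a γ γ' k ^ 2 / 4)
    (h2 : realDisc a b γ θ k * realDefect a γ γ' k < 0) :
    k ^ 2 ∈ discreteSpectrum (fiberOp a b γ γ' θ) := by
  have hkc : (k : ℂ) ≠ 0 := by exact_mod_cast hk.ne'
  have hsa' := sin_ofReal_ne_zero hsa
  have hsb' := sin_ofReal_ne_zero hsb
  set F := realDisc a b γ θ k with hFdef
  set s := realDefect a γ γ' k with hsdef
  have hs0 : s ≠ 0 := fun h => by simp [h] at h2
  have hs2 : 0 < s ^ 2 := by positivity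
  have hprod : (F + s / 2) * (F - s / 2) = 1 := by linear_combination h1
  have hμ1 : (F + s / 2) ^ 2 < 1 := by
    -- By the dispersion relation `(F s)² = s² + s⁴/4`, strictly more than `(s²/2)²`, and `F s` is
    -- negative. This is what makes `‖μ‖ < 1` strict.
    have h3 : F * s < -(s ^ 2 / 2) := by
      have h4 : (s ^ 2 / 2) ^ 2 < (-(F * s)) ^ 2 := by
        rw [neg_sq, mul_pow, h1]; nlinarith
      have := lt_of_pow_lt_pow_left₀ 2 (by linarith) h4
      linarith
    nlinarith
  have hF1 : 1 < |F| := by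
    rw [← one_lt_sq_iff_one_lt_abs]
    linarith
  set μ : ℂ := ((F + s / 2 : ℝ) : ℂ) with hμdef
  have hμinv : μ⁻¹ = ((F - s / 2 : ℝ) : ℂ) := by
    refine inv_eq_of_mul_eq_one_right ?_
    rw [hμdef, ← Complex.ofReal_mul, hprod, Complex.ofReal_one]
  have hμ0 : μ ≠ 0 := by
    rw [hμdef, Ne, Complex.ofReal_eq_zero]
    exact left_ne_zero_of_mul_eq_one hprod
  have hμn : ‖μ‖ < 1 := by
    rw [hμdef, Complex.norm_real, Real.norm_eq_abs]
    exact (sq_lt_one_iff_abs_lt_one _).1 hμ1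
  have hμF : μ + μ⁻¹ = 2 * disc a b γ θ k := by
    rw [hμinv, hμdef, disc_ofReal]; push_cast; ring
  have hμs : μ - μ⁻¹ = defect a γ γ' k := by
    rw [hμinv, hμdef, defect_ofReal]; push_cast; ring
  have hmem : Memℓp (combSol θ (k : ℂ) (fun j : ℤ => μ ^ j.natAbs) (0 : CombL2 a b)) 2 :=
    memℓp_combSol (memℓp_geometric hμn) 0
  obtain ⟨u, du, hu, hv, hup⟩ := combSol_mem_fiberGraph (γ := γ) (γ' := γ') (θ := θ) ha hb hkc
    hsa' hsb' 0 ⟨_, hmem⟩ (p := fun j : ℤ => μ ^ j.natAbs) (fun j => by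
      have hS : edgeSin (k : ℂ) (0 : CombL2 a b) = 0 := by
        funext e; exact map_zero (sinInt (k : ℂ) (len a b e))
      have hC : edgeCos (k : ℂ) (0 : CombL2 a b) = 0 := by
        funext e; exact map_zero (cosInt (k : ℂ) (len a b e))
      rw [geometric_recursion hμ0 hμF, hS, hC, hμs]
      simp [vertexSource, loopTerm]) (fun e => rfl)
  set ψ : CombL2 a b := ⟨_, hmem⟩ with hψ
  have hu' : ∀ e, IsNegSecondDeriv (len a b e) (ψ e) ((k : ℂ) ^ 2 • ψ e) (u e) (du e) := by
    intro e
    have := hu e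
    rwa [lp.coeFn_zero, Pi.zero_apply, zero_add] at this
  have hgr : (ψ, (k : ℂ) ^ 2 • ψ) ∈ fiberGraph a b γ γ' θ := ⟨u, du, hu', hv⟩
  have hψ0 : ψ ≠ 0 := by
    intro h0
    obtain ⟨C, hC⟩ := exists_trace_bound ha hkc
    have h3 := (hC _ _ _ (hu' (.hor 1))).1
    have h4 : u (.hor 1) 0 = 1 := by
      have := hv.cont_right 0
      rw [hup] at this
      simpa using this
    have h5 : ‖ψ (.hor 1)‖ = 0 := by rw [h0]; exact norm_zero
    rw [h4] at h3
    have h6 : ‖(1 : ℂ)‖ ≤ C * ‖ψ (.hor 1)‖ := h3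
    rw [h5] at h6
    norm_num at h6
  obtain ⟨hdom, -⟩ := mem_fiberOp_graph.1 hgr
  set x₀ : (fiberOp a b γ γ' θ).domain := ⟨ψ, hdom⟩ with hx₀
  have hcast : ((k ^ 2 : ℝ) : ℂ) = (k : ℂ) ^ 2 := by push_cast; rfl
  have hx₀mem : x₀ ∈ eigenspace (fiberOp a b γ γ' θ) ((k ^ 2 : ℝ) : ℂ) := by
    rw [mem_eigenspace_fiberOp, hcast]
    exact hgr
  have hx₀0 : x₀ ≠ 0 := fun h => hψ0 (congrArg Subtype.val h)
  refine ⟨?_, ?_, ?_, ?_⟩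
  · rintro ⟨R, -, hR⟩
    have h3 := hR x₀
    have h4 : fiberOp a b γ γ' θ x₀ - ((k ^ 2 : ℝ) : ℂ) • (x₀ : CombL2 a b) = 0 := hx₀mem
    rw [h4, map_zero] at h3
    exact hψ0 h3.symm
  · have hev := eventually_mem_resolventSet (γ := γ) (γ' := γ') (θ := θ) ha hb hk hsa hsb hF1
    rw [eventually_nhdsWithin_iff] at hev
    -- The principal square root is continuous at `k²` and maps it to `k`, so a punctured
    -- neighbourhood in the wave number becomes one in the energy.
    have hroot : ((k ^ 2 : ℝ) : ℂ) ^ ((2 : ℕ) : ℂ)⁻¹ = (k : ℂ) := by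
      have h3 : (k : ℂ) = (((k ^ 2 : ℝ) ^ ((2 : ℝ)⁻¹) : ℝ) : ℂ) := by
        rw [← Real.rpow_natCast, ← Real.rpow_mul hk.le]
        norm_num
      conv_rhs => rw [h3, Complex.ofReal_cpow (by positivity)]
      norm_num
    have hcont : ContinuousAt (fun z : ℂ => z ^ ((2 : ℕ) : ℂ)⁻¹) ((k ^ 2 : ℝ) : ℂ) :=
      continuousAt_cpow_const (Or.inl (by rw [Complex.ofReal_re]; positivity))
    have htend : Filter.Tendsto (fun z : ℂ => z ^ ((2 : ℕ) : ℂ)⁻¹) (nhds ((k ^ 2 : ℝ) : ℂ))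
        (nhds (k : ℂ)) := by
      have := hcont.tendsto
      rwa [hroot] at this
    obtain ⟨ε, hε, hball⟩ := Metric.eventually_nhds_iff.1 (htend.eventually hev)
    refine ⟨ε, hε, fun z hz hzε => ?_⟩
    by_contra hne
    apply hz
    have h3 := hball (by rwa [dist_eq_norm])
    have hsq : (z ^ ((2 : ℕ) : ℂ)⁻¹) ^ 2 = z := Complex.cpow_nat_inv_pow z two_ne_zero
    rw [hsq] at h3
    refine h3 fun h4 => hne ?_
    rw [← hsq, Set.mem_singleton_iff.1 h4, hcast]
  · exact (Submodule.ne_bot_iff _).2 ⟨x₀, hx₀mem, hx₀0⟩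
  -- Subtracting the multiple of `x₀` with the same value at `x_0` leaves a solution all of whose
  -- vertex values vanish.
  · have hle : eigenspace (fiberOp a b γ γ' θ) ((k ^ 2 : ℝ) : ℂ) ≤ Submodule.span ℂ {x₀} := by
      intro x hx
      rw [mem_eigenspace_fiberOp, hcast] at hx
      obtain ⟨v, dv, hv1, hv2⟩ := hx
      obtain ⟨hgeo, -⟩ := eigenfunction_vertex_values ha hb hkc hsb' hμ0 hμn.le hμF hv1 hv2
      rw [Submodule.mem_span_singleton]
      refine ⟨v (.hor 0) a, ?_⟩
      rw [eq_comm, ← sub_eq_zero]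
      have hsub : (x - v (.hor 0) a • x₀ : (fiberOp a b γ γ' θ).domain) =
          x + (-v (.hor 0) a) • x₀ := by rw [neg_smul, sub_eq_add_neg]
      rw [hsub]
      refine Subtype.ext ?_
      have hg : ∀ e, IsNegSecondDeriv (len a b e)
          (((x : CombL2 a b) + (-v (.hor 0) a) • ψ : CombL2 a b) e)
          ((k : ℂ) ^ 2 • ((x : CombL2 a b) + (-v (.hor 0) a) • ψ : CombL2 a b) e)
          ((v + (-v (.hor 0) a) • u) e) ((dv + (-v (.hor 0) a) • du) e) := by
        intro e
        have hx1 : IsNegSecondDeriv (len a b e) ((x : CombL2 a b) e)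
          ((k : ℂ) ^ 2 • (x : CombL2 a b) e) (v e) (dv e) := hv1 e
        have h3 := hx1.add ((hu' e).smul (-v (.hor 0) a))
        rw [smul_comm, ← smul_add] at h3
        exact h3
      refine eq_zero_of_vertex_values ha hb hkc hsa' hsb' hg
        (?_ : VertexConditions a b γ γ' θ (v + (-v (.hor 0) a) • u) (dv + (-v (.hor 0) a) • du)) ?_
      · constructor <;> intro j <;>
          simp only [Pi.add_apply, Pi.smul_apply, smul_eq_mul]
        · rw [hv2.cont_right, hv.cont_right]
        · rw [hv2.cont_up, hv.cont_up]
        · rw [hv2.cont_down, hv.cont_down]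
        · linear_combination hv2.delta j + (-v (.hor 0) a) * hv.delta j
        · linear_combination hv2.quasi j + (-v (.hor 0) a) * hv.quasi j
        · linear_combination hv2.quasi_deriv j + (-v (.hor 0) a) * hv.quasi_deriv j
      · intro j
        simp only [Pi.add_apply, Pi.smul_apply, smul_eq_mul]
        rw [hgeo j, hup j]
        ring
    exact Submodule.finiteDimensional_of_le hle

end

section

/-! ### Weighted means of periodic functions -/

/-- The mean of a function over `[0, R]` with respect to the weight `2 k`. -/
def weightedMean (f : ℝ → ℝ) (R : ℝ) : ℝ := (∫ k in (0 : ℝ)..R, 2 * k * f k) / R ^ 2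

theorem intervalIntegrable_of_bounded {f : ℝ → ℝ} {B : ℝ} (hm : Measurable f)
    (hB : ∀ x, |f x| ≤ B) (x y : ℝ) : IntervalIntegrable f volume x y :=
  (intervalIntegrable_const (c := B)).mono_fun' hm.aestronglyMeasurable
    (ae_of_all _ fun t => hB t)

theorem intervalIntegrable_weighted {f : ℝ → ℝ} {B : ℝ} (hm : Measurable f)
    (hB : ∀ x, |f x| ≤ B) (x y : ℝ) : IntervalIntegrable (fun k => 2 * k * f k) volume x y :=
  (intervalIntegrable_of_bounded hm hB x y).continuousOn_mul (by fun_prop)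

theorem weightedMean_add {f g : ℝ → ℝ} {B D : ℝ} (hf : Measurable f) (hg : Measurable g)
    (hB : ∀ x, |f x| ≤ B) (hD : ∀ x, |g x| ≤ D) (R : ℝ) :
    weightedMean (fun k => f k + g k) R = weightedMean f R + weightedMean g R := by
  unfold weightedMean
  rw [← add_div, ← intervalIntegral.integral_add (intervalIntegrable_weighted hf hB 0 R)
    (intervalIntegrable_weighted hg hD 0 R)]
  simp only [mul_add]

theorem weightedMean_sub {f g : ℝ → ℝ} {B D : ℝ} (hf : Measurable f) (hg : Measurable g)
    (hB : ∀ x, |f x| ≤ B) (hD : ∀ x, |g x| ≤ D) (R : ℝ) :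
    weightedMean (fun k => f k - g k) R = weightedMean f R - weightedMean g R := by
  unfold weightedMean
  rw [← sub_div, ← intervalIntegral.integral_sub (intervalIntegrable_weighted hf hB 0 R)
    (intervalIntegrable_weighted hg hD 0 R)]
  simp only [mul_sub]

theorem weightedMean_const (c : ℝ) {R : ℝ} (hR : R ≠ 0) : weightedMean (fun _ => c) R = c := by
  unfold weightedMean
  rw [intervalIntegral.integral_mul_const, intervalIntegral.integral_const_mul, integral_id]
  field_simp
  ring

/-- After subtraction of the mean, the primitive `P` is periodic and therefore bounded. Integrating
by parts, `∫ 2 k g = 2 R P(R) - ∫ 2 P = O(R)`, negligible against `R²`. -/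
theorem tendsto_weightedMean_of_periodic {f : ℝ → ℝ} {B T : ℝ} (hm : Measurable f)
    (hB : ∀ x, |f x| ≤ B) (hT : 0 < T) (hper : Function.Periodic f T) :
    Filter.Tendsto (weightedMean f) Filter.atTop (nhds ((∫ k in (0 : ℝ)..T, f k) / T)) := by
  set m := (∫ k in (0 : ℝ)..T, f k) / T with hmdef
  set g : ℝ → ℝ := fun k => f k - m with hg
  have hgm : Measurable g := hm.sub_const m
  have hgB : ∀ x, |g x| ≤ B + |m| := fun x => (abs_sub _ _).trans (by gcongr; exact hB x)
  have hgi := intervalIntegrable_of_bounded hgm hgB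
  have hgper : Function.Periodic g T := fun x => by simp only [hg, hper x]
  set P : ℝ → ℝ := fun x => ∫ k in (0 : ℝ)..x, g k with hP
  have hPT : ∫ k in (0 : ℝ)..T, g k = 0 := by
    rw [hg, intervalIntegral.integral_sub (intervalIntegrable_of_bounded hm hB 0 T)
      intervalIntegrable_const, intervalIntegral.integral_const, hmdef, sub_zero, smul_eq_mul]
    field_simp
    ring
  have hPper : Function.Periodic P T := by
    intro x
    simp only [hP]
    rw [← intervalIntegral.integral_add_adjacent_intervals (hgi 0 x) (hgi x (x + T)),
      hgper.intervalIntegral_add_eq x 0, zero_add, hPT, add_zero]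
  set C := (B + |m|) * T with hC
  have hBm : 0 ≤ B + |m| := (abs_nonneg _).trans (hgB 0)
  have hPC : ∀ x, |P x| ≤ C := by
    intro x
    obtain ⟨y, hy, hxy⟩ := hPper.exists_mem_Ico₀ hT x
    rw [hxy]
    have := intervalIntegral.norm_integral_le_of_norm_le_const (a := 0) (b := y) (f := g)
      (C := B + |m|) (fun t _ => by rw [Real.norm_eq_abs]; exact hgB t)
    rw [Real.norm_eq_abs, sub_zero, abs_of_nonneg hy.1] at this
    refine this.trans ?_
    rw [hC]
    gcongr
    exact hy.2.le
  have hparts : ∀ R, ∫ k in (0 : ℝ)..R, 2 * k * g k = 2 * R * P R - ∫ k in (0 : ℝ)..R, 2 * P k := by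
    intro R
    have hPac : AbsolutelyContinuousOnInterval P 0 R :=
      absolutelyContinuousOnInterval_primitive (hgi 0 R) Set.left_mem_uIcc
    have hlin : AbsolutelyContinuousOnInterval (fun k : ℝ => 2 * k) 0 R :=
      (contDiff_const.mul contDiff_id).contDiffOn.absolutelyContinuousOnInterval
    have hi1 : IntervalIntegrable (fun k => 2 * P k) volume 0 R :=
      (hPac.continuousOn.intervalIntegrable).const_mul 2
    have hi2 := intervalIntegrable_weighted hgm hgB 0 R
    have key := eq_add_integral_of_absolutelyContinuous (hlin.mul hPac) (hi1.add hi2) (by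
      filter_upwards [(hgi 0 R).ae_hasDerivAt_integral] with x hx hxI
      have h1 := hx hxI 0 Set.left_mem_uIcc
      have h2 : HasDerivAt (fun k : ℝ => 2 * k) 2 x := by
        simpa using (hasDerivAt_id x).const_mul (2 : ℝ)
      exact h2.mul h1)
    simp only [Pi.mul_apply, mul_zero, zero_mul, zero_add] at key
    rw [intervalIntegral.integral_add hi1 hi2] at key
    linarith
  have hbound : ∀ R > 0, |weightedMean f R - m| ≤ 4 * C / R := by
    intro R hR
    have h1 : weightedMean f R - m = weightedMean g R := by
      rw [hg, weightedMean_sub (D := |m|) hm measurable_const hB (fun _ => le_rfl),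
        weightedMean_const m hR.ne']
    rw [h1, weightedMean, hparts, abs_div, abs_of_pos (pow_pos hR 2)]
    have h2 : |∫ k in (0 : ℝ)..R, 2 * P k| ≤ 2 * C * R := by
      have := intervalIntegral.norm_integral_le_of_norm_le_const (a := 0) (b := R)
        (f := fun k => 2 * P k) (C := 2 * C) (fun t _ => by
          rw [Real.norm_eq_abs, abs_mul, abs_two]
          gcongr
          exact hPC t)
      rwa [Real.norm_eq_abs, sub_zero, abs_of_pos hR] at this
    have h3 : |2 * R * P R| ≤ 2 * R * C := by
      rw [abs_mul, abs_of_pos (by positivity)]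
      gcongr
      exact hPC R
    rw [div_le_div_iff₀ (by positivity) hR]
    have h4 := (abs_sub (2 * R * P R) (∫ k in (0 : ℝ)..R, 2 * P k)).trans (add_le_add h3 h2)
    nlinarith
  rw [tendsto_iff_norm_sub_tendsto_zero]
  refine squeeze_zero' (Filter.Eventually.of_forall fun R => norm_nonneg _)
    (Filter.eventually_gt_atTop 0 |>.mono fun R hR => hbound R hR) ?_
  exact tendsto_const_nhds.div_atTop Filter.tendsto_id

theorem tendsto_weightedMean_fract {c : ℝ} (hc : 0 < c) :
    Filter.Tendsto (weightedMean fun k => Int.fract (c * k)) Filter.atTop (nhds (1 / 2)) := by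
  have hper : Function.Periodic (fun k => Int.fract (c * k)) c⁻¹ := by
    intro k
    simp only [mul_add, mul_inv_cancel₀ hc.ne', Int.fract_add_one]
  have h := tendsto_weightedMean_of_periodic (B := 1) (measurable_fract.comp (measurable_const_mul c))
    (fun x => by
      simp only [Function.comp]
      rw [abs_of_nonneg (Int.fract_nonneg _)]
      exact (Int.fract_lt_one _).le) (inv_pos.2 hc) hper
  convert! h using 2
  have hI : ∫ k in (0 : ℝ)..c⁻¹, (Int.fract ∘ fun k => c * k) k = ∫ k in (0 : ℝ)..c⁻¹, c * k := by
    rw [intervalIntegral.integral_of_le (inv_pos.2 hc).le,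
      intervalIntegral.integral_of_le (inv_pos.2 hc).le, ← integral_Icc_eq_integral_Ioc,
      ← integral_Icc_eq_integral_Ioc, integral_Icc_eq_integral_Ico, integral_Icc_eq_integral_Ico]
    refine setIntegral_congr_fun measurableSet_Ico fun k hk => ?_
    refine Int.fract_eq_self.2 ⟨mul_nonneg hc.le hk.1, ?_⟩
    have := mul_lt_mul_of_pos_left hk.2 hc
    rwa [mul_inv_cancel₀ hc.ne'] at this
  rw [hI, intervalIntegral.integral_const_mul, integral_id]
  field_simp
  norm_num

/-- The indicator of the set where `sin (k c)` is at most `δ` in absolute value. -/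
def sinSmall (c δ : ℝ) (k : ℝ) : ℝ := if |Real.sin (k * c)| ≤ δ then 1 else 0

theorem measurable_sinSmall (c δ : ℝ) : Measurable (sinSmall c δ) :=
  Measurable.ite (measurableSet_le (by fun_prop) (by fun_prop)) measurable_const measurable_const

theorem sinSmall_nonneg (c δ k : ℝ) : 0 ≤ sinSmall c δ k := by
  unfold sinSmall; split_ifs <;> norm_num

theorem abs_sinSmall_le (c δ k : ℝ) : |sinSmall c δ k| ≤ 1 := by
  unfold sinSmall; split_ifs <;> norm_num

theorem periodic_sinSmall {c : ℝ} (hc : 0 < c) (δ : ℝ) :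
    Function.Periodic (sinSmall c δ) (Real.pi / c) := by
  intro k
  have : (k + Real.pi / c) * c = k * c + Real.pi := by field_simp
  rw [sinSmall, this, Real.sin_add_pi, abs_neg, sinSmall]

theorem ae_sin_ne_zero {c : ℝ} (hc : 0 < c) : ∀ᵐ k : ℝ, Real.sin (k * c) ≠ 0 := by
  have hcount : {k : ℝ | Real.sin (k * c) = 0}.Countable := by
    refine (Set.countable_range fun n : ℤ => n * Real.pi / c).mono fun k hk => ?_
    obtain ⟨n, hn⟩ := Real.sin_eq_zero_iff.1 hk
    exact ⟨n, by simp only; rw [hn]; field_simp⟩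
  exact measure_eq_zero_iff_ae_notMem.1 (hcount.measure_zero volume)

/-- The zeros of the sine form a null set, so dominated convergence applies. Neighbourhoods of these
zeros can thus be given arbitrarily small density. -/
theorem tendsto_mean_sinSmall {c : ℝ} (hc : 0 < c) :
    Filter.Tendsto (fun n : ℕ => (∫ k in (0 : ℝ)..(Real.pi / c), sinSmall c (1 / ((n : ℝ) + 1)) k) /
      (Real.pi / c)) Filter.atTop (nhds 0) := by
  have h : Filter.Tendsto (fun n : ℕ => ∫ k in (0 : ℝ)..(Real.pi / c),
      sinSmall c (1 / ((n : ℝ) + 1)) k) Filter.atTop (nhds (∫ _k in (0 : ℝ)..(Real.pi / c), (0 : ℝ))) := by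
    refine intervalIntegral.tendsto_integral_filter_of_dominated_convergence (fun _ => 1)
      (Filter.Eventually.of_forall fun n => (measurable_sinSmall _ _).aestronglyMeasurable)
      (Filter.Eventually.of_forall fun n => ae_of_all _ fun k _ => abs_sinSmall_le _ _ k)
      intervalIntegrable_const ?_
    filter_upwards [ae_sin_ne_zero hc] with k hk _
    refine tendsto_const_nhds.congr' ?_
    have := (tendsto_one_div_add_atTop_nhds_zero_nat (𝕜 := ℝ)).eventually_lt_const (abs_pos.2 hk)
    filter_upwards [this] with n hn
    rw [sinSmall, if_neg (not_le.2 hn)]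
  simpa using h.div_const (Real.pi / c)

/-- A bounded function that agrees asymptotically with another one off the sets where a sine is
small has the same weighted mean. -/
theorem tendsto_weightedMean_of_approx {f g : ℝ → ℝ} {c d l : ℝ} (hc : 0 < c) (hd : 0 < d)
    (hf : Measurable f) (hg : Measurable g) (hf1 : ∀ k, f k ∈ Set.Icc 0 1)
    (hg1 : ∀ k, g k ∈ Set.Icc 0 1)
    (happ : ∀ δ > 0, δ ≤ 1 → ∃ k₀, 0 ≤ k₀ ∧ ∀ᵐ k : ℝ, k₀ ≤ k → δ < |Real.sin (k * c)| →
      δ < |Real.sin (k * d)| → f k = g k)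
    (hlim : Filter.Tendsto (weightedMean g) Filter.atTop (nhds l)) :
    Filter.Tendsto (weightedMean f) Filter.atTop (nhds l) := by
  have hfB : ∀ k, |f k| ≤ 1 := fun k => by rw [abs_of_nonneg (hf1 k).1]; exact (hf1 k).2
  have hgB : ∀ k, |g k| ≤ 1 := fun k => by rw [abs_of_nonneg (hg1 k).1]; exact (hg1 k).2
  have hdiff : Filter.Tendsto (fun R => weightedMean f R - weightedMean g R) Filter.atTop
      (nhds 0) := by
    rw [Metric.tendsto_nhds]
    intro ε hε
    -- The threshold `δ` is fixed first, so that the exceptional set where a sine is small has mean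
    -- below `ε / 2`; then `R` is taken large enough to absorb `k < k₀` in the other half.
    have hm := ((tendsto_mean_sinSmall hc).add (tendsto_mean_sinSmall hd)).eventually_lt_const
      (show (0 : ℝ) + 0 < ε / 2 by linarith)
    obtain ⟨n, hn⟩ := hm.exists
    set δ := 1 / ((n : ℝ) + 1) with hδdef
    have hδ : 0 < δ := by positivity
    have hδ1 : δ ≤ 1 := by
      rw [hδdef, div_le_one (by positivity)]
      linarith [n.cast_nonneg (α := ℝ)]
    obtain ⟨k₀, hk₀, happ⟩ := happ δ hδ hδ1
    have hbad := (tendsto_weightedMean_of_periodic (measurable_sinSmall c δ) (abs_sinSmall_le c δ)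
      (by positivity) (periodic_sinSmall hc δ)).add
      (tendsto_weightedMean_of_periodic (measurable_sinSmall d δ) (abs_sinSmall_le d δ)
      (by positivity) (periodic_sinSmall hd δ))
    have hsmall : Filter.Tendsto (fun R : ℝ => k₀ ^ 2 / R ^ 2) Filter.atTop (nhds 0) :=
      tendsto_const_nhds.div_atTop (Filter.tendsto_pow_atTop two_ne_zero)
    filter_upwards [hbad.eventually_lt_const hn, hsmall.eventually_lt_const (half_pos hε),
      Filter.eventually_gt_atTop 0, Filter.eventually_ge_atTop k₀] with R h1 h2 hR hRk
    rw [dist_zero_right, Real.norm_eq_abs]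
    have hsub := weightedMean_sub hf hg hfB hgB R
    rw [← hsub]
    -- The indicator of low wave numbers: `|f - g|` is at most 1 everywhere and vanishes a.e. off
    -- `q` and the two sets of small sines.
    let q : ℝ → ℝ := fun k => if k < k₀ then 1 else 0
    have hq : Measurable q := Measurable.ite measurableSet_Iio measurable_const measurable_const
    have hqB : ∀ k, |q k| ≤ 1 := fun k => by simp only [q]; split_ifs <;> norm_num
    have hqmean : weightedMean q R = k₀ ^ 2 / R ^ 2 := by
      unfold weightedMean
      congr 1
      have hqi := intervalIntegrable_weighted hq hqB
      rw [← intervalIntegral.integral_add_adjacent_intervals (hqi 0 k₀) (hqi k₀ R)]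
      have i1 : ∫ k in (0 : ℝ)..k₀, 2 * k * q k = ∫ k in (0 : ℝ)..k₀, 2 * k := by
        rw [intervalIntegral.integral_of_le hk₀, intervalIntegral.integral_of_le hk₀,
          ← integral_Icc_eq_integral_Ioc, ← integral_Icc_eq_integral_Ioc,
          integral_Icc_eq_integral_Ico, integral_Icc_eq_integral_Ico]
        refine setIntegral_congr_fun measurableSet_Ico fun k hk => ?_
        simp only [q, if_pos hk.2, mul_one]
      have i2 : ∫ k in k₀..R, 2 * k * q k = 0 := by
        rw [intervalIntegral.integral_congr (g := fun _ => 0)]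
        · simp
        · intro k hk
          rw [Set.uIcc_of_le hRk] at hk
          simp only [q, if_neg (not_lt.2 hk.1), mul_zero]
      rw [i1, i2, intervalIntegral.integral_const_mul, integral_id]
      ring
    have hle : |weightedMean (fun k => f k - g k) R| ≤
        weightedMean (fun k => q k + (sinSmall c δ k + sinSmall d δ k)) R := by
      unfold weightedMean
      rw [abs_div, abs_of_pos (pow_pos hR 2)]
      gcongr
      rw [← Real.norm_eq_abs]
      refine intervalIntegral.norm_integral_le_of_norm_le hR.le ?_
        (intervalIntegrable_weighted (B := 1 + (1 + 1)) (hq.add ((measurable_sinSmall c δ).add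
          (measurable_sinSmall d δ))) (fun k => (abs_add_le _ _).trans
            (add_le_add (hqB k) ((abs_add_le _ _).trans
              (add_le_add (abs_sinSmall_le c δ k) (abs_sinSmall_le d δ k))))) 0 R)
      filter_upwards [happ] with k hk hkI
      rw [Real.norm_eq_abs, abs_mul, abs_of_nonneg (by linarith [hkI.1])]
      refine mul_le_mul_of_nonneg_left ?_ (by linarith [hkI.1])
      have hc0 := sinSmall_nonneg c δ k
      have hd0 := sinSmall_nonneg d δ k
      have hfg : |f k - g k| ≤ 1 := by
        rw [abs_le]
        constructor <;> linarith [(hf1 k).1, (hf1 k).2, (hg1 k).1, (hg1 k).2]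
      by_cases h3 : k < k₀
      · simp only [q, if_pos h3]
        linarith
      have hq0 : q k = 0 := by simp only [q, if_neg h3]
      rw [hq0]
      by_cases h4 : |Real.sin (k * c)| ≤ δ
      · rw [show sinSmall c δ k = 1 from if_pos h4]
        linarith
      by_cases h5 : |Real.sin (k * d)| ≤ δ
      · rw [show sinSmall d δ k = 1 from if_pos h5]
        linarith
      rw [hk (not_lt.1 h3) (not_le.1 h4) (not_le.1 h5), sub_self, abs_zero]
      linarith
    rw [weightedMean_add (g := fun k => sinSmall c δ k + sinSmall d δ k) (B := 1) (D := 1 + 1) hq ((measurable_sinSmall c δ).add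
      (measurable_sinSmall d δ)) hqB (fun k => (abs_add_le _ _).trans
        (add_le_add (abs_sinSmall_le c δ k) (abs_sinSmall_le d δ k))), hqmean,
      weightedMean_add (measurable_sinSmall c δ) (measurable_sinSmall d δ) (abs_sinSmall_le c δ)
        (abs_sinSmall_le d δ)] at hle
    linarith
  simpa using hdiff.add hlim

end

section

variable {a b γ γ' : ℝ}

/-! ### The induced bands in terms of the wave number -/

/-- The sign of the defect term. -/
def defectSign (a γ γ' k : ℝ) : ℝ := if 0 < (γ' - γ) * Real.sin (k * a) then 1 else -1

/-- The cosine of the quasimomentum for which `k²` is an eigenvalue. -/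
def bandFun (a b γ γ' k : ℝ) : ℝ :=
  Real.cos (k * b) + Real.sin (k * b) / Real.sin (k * a) * (Real.cos (k * a) +
    defectSign a γ γ' k * √(1 + realDefect a γ γ' k ^ 2 / 4)) + γ * Real.sin (k * b) / (2 * k)

/-- The high-energy limit of `bandFun`. -/
def bandFunLim (a b γ γ' k : ℝ) : ℝ :=
  Real.cos (k * b) + Real.sin (k * b) / Real.sin (k * a) *
    (Real.cos (k * a) + defectSign a γ γ' k)

theorem measurable_defectSign : Measurable (defectSign a γ γ') :=
  Measurable.ite (measurableSet_lt (by fun_prop) (by fun_prop)) measurable_const measurable_const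

theorem measurable_bandFun : Measurable (bandFun a b γ γ') := by
  have h := measurable_defectSign (a := a) (γ := γ) (γ' := γ')
  have h' : Measurable (realDefect a γ γ') := by
    unfold realDefect
    fun_prop
  unfold bandFun
  fun_prop

/-- The condition `F s < 0` selects the root `F = -τ √(1 + s²/4)`, with `τ` the sign of `s`. Since
`F` is affine in `cos θ` with slope `-sin ka / sin kb ≠ 0`, this can be solved for `cos θ`. -/
theorem dispersion_iff {k θ : ℝ} (hk : 0 < k) (hγ : γ' ≠ γ) (hsa : Real.sin (k * a) ≠ 0)
    (hsb : Real.sin (k * b) ≠ 0) :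
    (realDisc a b γ θ k ^ 2 = 1 + realDefect a γ γ' k ^ 2 / 4 ∧
      realDisc a b γ θ k * realDefect a γ γ' k < 0) ↔ Real.cos θ = bandFun a b γ γ' k := by
  have hX : 0 < (γ' - γ) * Real.sin (k * a) ↔ 0 < realDefect a γ γ' k := by
    rw [realDefect, div_pos_iff_of_pos_right hk]
  have hs0 : realDefect a γ γ' k ≠ 0 :=
    div_ne_zero (mul_ne_zero (sub_ne_zero.2 hγ) hsa) hk.ne'
  have h1 : (realDisc a b γ θ k ^ 2 = 1 + realDefect a γ γ' k ^ 2 / 4 ∧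
      realDisc a b γ θ k * realDefect a γ γ' k < 0) ↔
      realDisc a b γ θ k = -(defectSign a γ γ' k * √(1 + realDefect a γ γ' k ^ 2 / 4)) := by
    rw [defectSign]
    simp only [hX]
    set s := realDefect a γ γ' k
    set F := realDisc a b γ θ k
    have hr : 0 < √(1 + s ^ 2 / 4) := Real.sqrt_pos.2 (by positivity)
    have hrsq : √(1 + s ^ 2 / 4) ^ 2 = 1 + s ^ 2 / 4 := Real.sq_sqrt (by positivity)
    generalize √(1 + s ^ 2 / 4) = r at hr hrsq ⊢
    rw [← hrsq]
    split_ifs with hs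
    · constructor
      · rintro ⟨h1, h2⟩
        have hF : F < 0 := by by_contra h; push Not at h; nlinarith
        rcases sq_eq_sq_iff_eq_or_eq_neg.1 h1 with h | h <;> linarith
      · intro h
        exact ⟨by rw [h]; ring, by rw [h]; nlinarith⟩
    · have hs : s < 0 := lt_of_le_of_ne (not_lt.1 hs) hs0
      constructor
      · rintro ⟨h1, h2⟩
        have hF : 0 < F := by by_contra h; push Not at h; nlinarith
        rcases sq_eq_sq_iff_eq_or_eq_neg.1 h1 with h | h <;> linarith
      · intro h
        exact ⟨by rw [h]; ring, by rw [h]; nlinarith⟩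
  rw [h1, realDisc, bandFun]
  generalize defectSign a γ γ' k * √(1 + realDefect a γ γ' k ^ 2 / 4) = q
  constructor
  · intro h
    field_simp at h ⊢
    linear_combination -h
  · intro h
    rw [h]
    field_simp
    ring

theorem mem_inducedBands_iff (ha : 0 < a) (hb : 0 < b) (hγ : γ' ≠ γ) {k : ℝ} (hk : 0 < k)
    (hsa : Real.sin (k * a) ≠ 0) (hsb : Real.sin (k * b) ≠ 0) :
    k ^ 2 ∈ inducedBands a b γ γ' ↔ |bandFun a b γ γ' k| ≤ 1 := by
  simp only [inducedBands, Set.mem_iUnion]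
  constructor
  · rintro ⟨θ, -, -, -, h, -⟩
    rw [← (dispersion_iff hk hγ hsa hsb).1 (dispersion_of_eigenvalue ha hb hk hγ hsa hsb h)]
    exact Real.abs_cos_le_one θ
  · intro h
    rw [abs_le] at h
    refine ⟨Real.arccos (bandFun a b γ γ' k),
      ⟨by linarith [Real.arccos_nonneg (bandFun a b γ γ' k), Real.pi_pos], Real.arccos_le_pi _⟩, ?_⟩
    obtain ⟨h1, h2⟩ := (dispersion_iff hk hγ hsa hsb).2 (Real.cos_arccos h.1 h.2)
    exact mem_discreteSpectrum ha hb hk hsa hsb h1 h2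

/-! ### The high-energy limit -/

theorem defectSign_sq (a γ γ' k : ℝ) : defectSign a γ γ' k ^ 2 = 1 := by
  unfold defectSign; split_ifs <;> norm_num

/-- One has `√(1 + s²/4) - 1 ≤ s²/8`, and `s²` carries a factor `sin² ka` that absorbs the `1 / sin
ka` in front. The bound is therefore uniform up to the zeros of `sin ka`. -/
theorem abs_bandFun_sub_le {k : ℝ} (hk : 1 ≤ k) (hsa : Real.sin (k * a) ≠ 0) :
    |bandFun a b γ γ' k - bandFunLim a b γ γ' k| ≤ ((γ' - γ) ^ 2 / 8 + |γ| / 2) / k := by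
  have hk0 : 0 < k := by linarith
  set s := realDefect a γ γ' k with hs
  set τ := defectSign a γ γ' k
  have hτ : |τ| = 1 := by
    rw [← sq_eq_sq₀ (abs_nonneg _) zero_le_one, sq_abs, one_pow]; exact defectSign_sq a γ γ' k
  have hr0 : 0 ≤ √(1 + s ^ 2 / 4) - 1 := by
    rw [sub_nonneg, Real.one_le_sqrt]; nlinarith [sq_nonneg s]
  have hr1 : √(1 + s ^ 2 / 4) - 1 ≤ s ^ 2 / 8 := by
    rw [sub_le_iff_le_add, Real.sqrt_le_left (by positivity)]
    nlinarith [sq_nonneg (s ^ 2)]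
  have hsab := Real.abs_sin_le_one (k * a)
  have hsbb := Real.abs_sin_le_one (k * b)
  have hpos : 0 < |Real.sin (k * a)| := abs_pos.2 hsa
  have e : bandFun a b γ γ' k - bandFunLim a b γ γ' k =
      Real.sin (k * b) / Real.sin (k * a) * (τ * (√(1 + s ^ 2 / 4) - 1)) +
      γ * Real.sin (k * b) / (2 * k) := by
    simp only [bandFun, bandFunLim]; ring
  have e2 : s ^ 2 = (γ' - γ) ^ 2 * |Real.sin (k * a)| ^ 2 / k ^ 2 := by
    rw [hs, realDefect, sq_abs]; ring
  have b1 : |Real.sin (k * b) / Real.sin (k * a) * (τ * (√(1 + s ^ 2 / 4) - 1))| ≤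
      (γ' - γ) ^ 2 / 8 / k := by
    rw [abs_mul, abs_div, abs_mul, hτ, one_mul, abs_of_nonneg hr0]
    calc _ ≤ 1 / |Real.sin (k * a)| * (s ^ 2 / 8) := by gcongr
      _ = (γ' - γ) ^ 2 / 8 * |Real.sin (k * a)| / k ^ 2 := by rw [e2]; field_simp
      _ ≤ (γ' - γ) ^ 2 / 8 * 1 / k ^ 1 := by gcongr; norm_num [hk]
      _ = _ := by ring
  have b2 : |γ * Real.sin (k * b) / (2 * k)| ≤ |γ| / 2 / k := by
    rw [abs_div, abs_mul, abs_of_pos (show 0 < 2 * k by positivity), div_div]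
    gcongr
    exact mul_le_of_le_one_right (abs_nonneg _) hsbb
  rw [e, add_div]
  exact (abs_add_le _ _).trans (add_le_add b1 b2)

/-- As `τ² = 1`, `(cos ka + τ)² - sin² ka = 2 cos ka (cos ka + τ)`. Hence `cos ka + τ` factors out,
and the addition formula for `sin k(a+b)` remains. -/
theorem bandFunLim_sq_sub_one {k : ℝ} (hsa : Real.sin (k * a) ≠ 0) :
    bandFunLim a b γ γ' k ^ 2 - 1 = 2 * (Real.cos (k * a) + defectSign a γ γ' k) *
      (Real.sin (k * b) * Real.sin (k * (a + b))) / Real.sin (k * a) ^ 2 := by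
  have h1 := Real.sin_sq_add_cos_sq (k * a)
  have h2 := Real.sin_sq_add_cos_sq (k * b)
  have h3 := defectSign_sq a γ γ' k
  rw [mul_add k, Real.sin_add, bandFunLim]
  generalize defectSign a γ γ' k = τ at *
  generalize Real.sin (k * a) = sA at *
  generalize Real.cos (k * a) = cA at *
  generalize Real.sin (k * b) = sB at *
  generalize Real.cos (k * b) = cB at *
  field_simp
  linear_combination sA ^ 2 * h2 - sB ^ 2 * h1 + sB ^ 2 * h3

/-- The sign of `bandFunLim² - 1`, with a lower bound. -/
theorem bandFunLim_bound {k : ℝ} (hγ : γ' ≠ γ) (hsa : Real.sin (k * a) ≠ 0) :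
    (0 < (γ' - γ) * (Real.sin (k * a) * Real.sin (k * b) * Real.sin (k * (a + b))) →
      |Real.sin (k * b)| * |Real.sin (k * (a + b))| ≤ bandFunLim a b γ γ' k ^ 2 - 1) ∧
    ((γ' - γ) * (Real.sin (k * a) * Real.sin (k * b) * Real.sin (k * (a + b))) < 0 →
      bandFunLim a b γ γ' k ^ 2 - 1 ≤ -(|Real.sin (k * b)| * |Real.sin (k * (a + b))|)) := by
  rw [bandFunLim_sq_sub_one hsa, ← abs_mul]
  have h1 := Real.sin_sq_add_cos_sq (k * a)
  have hc1 := Real.neg_one_le_cos (k * a)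
  have hc2 := Real.cos_le_one (k * a)
  have hX0 : (γ' - γ) * Real.sin (k * a) ≠ 0 := mul_ne_zero (sub_ne_zero.2 hγ) hsa
  have hassoc : (γ' - γ) * (Real.sin (k * a) * Real.sin (k * b) * Real.sin (k * (a + b))) =
      (γ' - γ) * Real.sin (k * a) * (Real.sin (k * b) * Real.sin (k * (a + b))) := by ring
  rw [hassoc]
  have hsq : 0 < Real.sin (k * a) ^ 2 := by positivity
  rw [defectSign]
  generalize Real.sin (k * b) * Real.sin (k * (a + b)) = Y
  generalize (γ' - γ) * Real.sin (k * a) = X at *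
  generalize Real.cos (k * a) = c at *
  generalize Real.sin (k * a) = sA at *
  -- From `sin² = (1 - c)(1 + c) ≤ 2 (1 ± c)`: the factor `2 (c + τ) / sin²` has the sign of `τ` and
  -- modulus at least 1.
  have hpos : sA ^ 2 ≤ 2 * (c + 1) := by nlinarith
  have hneg : sA ^ 2 ≤ 2 * (1 - c) := by nlinarith
  split_ifs with hX
  · constructor
    · intro h
      have hY : 0 < Y := by by_contra h'; push Not at h'; nlinarith
      rw [abs_of_pos hY, le_div_iff₀ hsq]
      nlinarith
    · intro h
      have hY : Y < 0 := by by_contra h'; push Not at h'; nlinarith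
      rw [abs_of_neg hY, div_le_iff₀ hsq]
      nlinarith
  · have hX : X < 0 := lt_of_le_of_ne (not_lt.1 hX) hX0
    constructor
    · intro h
      have hY : Y < 0 := by by_contra h'; push Not at h'; nlinarith
      rw [abs_of_neg hY, le_div_iff₀ hsq]
      nlinarith
    · intro h
      have hY : 0 < Y := by by_contra h'; push Not at h'; nlinarith
      rw [abs_of_pos hY, div_le_iff₀ hsq]
      nlinarith

/-- Off the zeros of two sines, membership in the bands at high energy is decided by a sign. -/
theorem abs_bandFun_le_one_iff {k δ : ℝ} (hγ : γ' ≠ γ) (hδ : 0 < δ) (hδ1 : δ ≤ 1) (hk : 1 ≤ k)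
    (hkδ : ((γ' - γ) ^ 2 / 8 + |γ| / 2) / k < δ ^ 2 / 4) (hsa : Real.sin (k * a) ≠ 0)
    (hsb : δ < |Real.sin (k * b)|) (hsab : δ < |Real.sin (k * (a + b))|) :
    |bandFun a b γ γ' k| ≤ 1 ↔
      (γ' - γ) * (Real.sin (k * a) * Real.sin (k * b) * Real.sin (k * (a + b))) < 0 := by
  obtain ⟨h1, h2⟩ := bandFunLim_bound (b := b) hγ hsa
  have hd := (abs_bandFun_sub_le (b := b) (γ := γ) (γ' := γ') hk hsa).trans_lt hkδ
  have hne : (γ' - γ) * (Real.sin (k * a) * Real.sin (k * b) * Real.sin (k * (a + b))) ≠ 0 :=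
    mul_ne_zero (sub_ne_zero.2 hγ) (mul_ne_zero (mul_ne_zero hsa (abs_pos.1 (hδ.trans hsb)))
      (abs_pos.1 (hδ.trans hsab)))
  have hprod : δ ^ 2 ≤ |Real.sin (k * b)| * |Real.sin (k * (a + b))| := by
    rw [sq]; gcongr
  set G := bandFun a b γ γ' k
  set G₀ := bandFunLim a b γ γ' k
  constructor
  · intro hG
    by_contra hn
    have hpos := lt_of_le_of_ne (not_lt.1 hn) hne.symm
    have h3 := h1 hpos
    -- For `δ ≤ 1`, `(1 + δ²/4)² ≤ 1 + δ² ≤ G₀²`. The margin `δ²/4` exceeds the distance from `G` to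
    -- `G₀`.
    have h4 : 1 + δ ^ 2 / 4 ≤ |G₀| := by
      refine le_of_sq_le_sq ?_ (abs_nonneg _)
      rw [sq_abs]
      have hδ2 : δ ^ 2 ≤ 1 := pow_le_one₀ hδ.le hδ1
      nlinarith [mul_nonneg (sq_nonneg δ) (sub_nonneg.2 hδ2)]
    have h5 := abs_sub_abs_le_abs_sub G₀ G
    rw [abs_sub_comm] at h5
    linarith
  · intro hneg
    have h3 := h2 hneg
    have h4 : |G₀| ≤ 1 - δ ^ 2 / 4 := by
      refine abs_le_of_sq_le_sq ?_ (by nlinarith)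
      nlinarith
    have h5 := abs_sub_abs_le_abs_sub G G₀
    linarith

/-! ### The sawtooth functions -/

/-- The carry of the fractional parts. -/
def carry (a b k : ℝ) : ℝ :=
  Int.fract (a / Real.pi * k) + Int.fract (b / Real.pi * k) - Int.fract ((a + b) / Real.pi * k)

theorem sin_eq_neg_one_zpow_mul (x : ℝ) :
    Real.sin (x * Real.pi) = (-1) ^ ⌊x⌋ * Real.sin (Int.fract x * Real.pi) := by
  conv_lhs => rw [← Int.fract_add_floor x, add_mul]
  exact Real.sin_add_int_mul_pi _ _

theorem sin_fract_nonneg (x : ℝ) : 0 ≤ Real.sin (Int.fract x * Real.pi) :=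
  Real.sin_nonneg_of_nonneg_of_le_pi (mul_nonneg (Int.fract_nonneg x) Real.pi_pos.le)
    (mul_le_of_le_one_left Real.pi_pos.le (Int.fract_lt_one x).le)

/-- Each `sin (π x)` is `(-1)^⌊x⌋` times a nonnegative sine of the fractional part. The product thus
has sign `(-1)^(⌊x⌋ + ⌊y⌋ + ⌊x+y⌋)`, and this exponent has the parity of the carry `⌊x+y⌋ - ⌊x⌋ -
⌊y⌋`. -/
theorem fract_carry (x y : ℝ) :
    (Int.fract x + Int.fract y - Int.fract (x + y) = 0 ∧
      0 ≤ Real.sin (x * Real.pi) * Real.sin (y * Real.pi) * Real.sin ((x + y) * Real.pi)) ∨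
    (Int.fract x + Int.fract y - Int.fract (x + y) = 1 ∧
      Real.sin (x * Real.pi) * Real.sin (y * Real.pi) * Real.sin ((x + y) * Real.pi) ≤ 0) := by
  have hx := sin_fract_nonneg x
  have hy := sin_fract_nonneg y
  have hxy := sin_fract_nonneg (x + y)
  have hfx := Int.floor_add_fract x
  have hfy := Int.floor_add_fract y
  have hfxy := Int.floor_add_fract (x + y)
  rw [sin_eq_neg_one_zpow_mul x, sin_eq_neg_one_zpow_mul y, sin_eq_neg_one_zpow_mul (x + y)]
  have hz : ∀ n : ℤ, ((-1 : ℝ) ^ n) * (-1) ^ n = 1 := fun n => by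
    rw [← mul_zpow]; norm_num
  have hn : ⌊x + y⌋ = ⌊x⌋ + ⌊y⌋ ∨ ⌊x + y⌋ = ⌊x⌋ + ⌊y⌋ + 1 := by
    have h1 := Int.le_floor_add x y
    have h2 := Int.le_floor_add_floor x y
    omega
  have hzz : (-1 : ℝ) ^ ⌊x⌋ * (-1) ^ ⌊y⌋ * (-1) ^ (⌊x⌋ + ⌊y⌋) = 1 := by
    rw [← zpow_add₀ (by norm_num), hz]
  have hP : 0 ≤ Real.sin (Int.fract x * Real.pi) * Real.sin (Int.fract y * Real.pi) *
      Real.sin (Int.fract (x + y) * Real.pi) := by positivity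
  rcases hn with hn | hn
  · left
    constructor
    · rw [hn] at hfxy
      push_cast at hfxy
      linarith
    · rw [hn]
      refine hP.trans_eq ?_
      linear_combination (-(Real.sin (Int.fract x * Real.pi) * Real.sin (Int.fract y * Real.pi) *
        Real.sin (Int.fract (x + y) * Real.pi))) * hzz
  · right
    constructor
    · rw [hn] at hfxy
      push_cast at hfxy
      linarith
    · rw [hn, zpow_add_one₀ (by norm_num)]
      refine le_of_eq_of_le ?_ (neg_nonpos.2 hP)
      linear_combination (-(Real.sin (Int.fract x * Real.pi) * Real.sin (Int.fract y * Real.pi) *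
        Real.sin (Int.fract (x + y) * Real.pi))) * hzz

theorem carry_cases (a b k : ℝ) :
    (carry a b k = 0 ∧ 0 ≤ Real.sin (k * a) * Real.sin (k * b) * Real.sin (k * (a + b))) ∨
    (carry a b k = 1 ∧ Real.sin (k * a) * Real.sin (k * b) * Real.sin (k * (a + b)) ≤ 0) := by
  have h := fract_carry (a / Real.pi * k) (b / Real.pi * k)
  have hpi := Real.pi_ne_zero
  have e1 : a / Real.pi * k * Real.pi = k * a := by field_simp
  have e2 : b / Real.pi * k * Real.pi = k * b := by field_simp
  have e3 : a / Real.pi * k + b / Real.pi * k = (a + b) / Real.pi * k := by ring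
  have e4 : (a + b) / Real.pi * k * Real.pi = k * (a + b) := by field_simp
  rw [e1, e2, e3, e4] at h
  exact h

theorem measurable_fract_mul (c : ℝ) : Measurable fun k : ℝ => Int.fract (c * k) :=
  measurable_fract.comp (measurable_const_mul c)

theorem abs_fract_le_one (x : ℝ) : |Int.fract x| ≤ 1 := by
  rw [abs_of_nonneg (Int.fract_nonneg x)]; exact (Int.fract_lt_one x).le

theorem measurable_carry : Measurable (carry a b) :=
  ((measurable_fract_mul _).add (measurable_fract_mul _)).sub (measurable_fract_mul _)

/-- Linearity of the mean replaces any joint equidistribution of `ka` and `kb`: each sawtooth is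
averaged over its own period. This is why commensurability of `a` and `b` plays no role. -/
theorem tendsto_weightedMean_carry (ha : 0 < a) (hb : 0 < b) :
    Filter.Tendsto (weightedMean (carry a b)) Filter.atTop (nhds (1 / 2)) := by
  have hpi := Real.pi_pos
  have h := ((tendsto_weightedMean_fract (div_pos ha hpi)).add
    (tendsto_weightedMean_fract (div_pos hb hpi))).sub
    (tendsto_weightedMean_fract (div_pos (add_pos ha hb) hpi))
  have e : weightedMean (carry a b) = fun R =>
      weightedMean (fun k => Int.fract (a / Real.pi * k)) R +
      weightedMean (fun k => Int.fract (b / Real.pi * k)) R -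
      weightedMean (fun k => Int.fract ((a + b) / Real.pi * k)) R := by
    funext R
    rw [← weightedMean_add (measurable_fract_mul _) (measurable_fract_mul _)
      (fun k => abs_fract_le_one _) (fun k => abs_fract_le_one _),
      ← weightedMean_sub (B := 1 + 1)
      (f := fun k => Int.fract (a / Real.pi * k) + Int.fract (b / Real.pi * k))
      ((measurable_fract_mul _).add (measurable_fract_mul _))
      (measurable_fract_mul _) (fun k => (abs_add_le _ _).trans
        (add_le_add (abs_fract_le_one _) (abs_fract_le_one _))) (fun k => abs_fract_le_one _)]
    rfl
  rw [e]
  convert! h using 2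
  norm_num

/-! ### The measure of the bands -/

/-- The wave numbers of the induced bands, up to a null set. -/
def bandSet (a b γ γ' : ℝ) : Set ℝ :=
  {k | |bandFun a b γ γ' k| ≤ 1 ∧ Real.sin (k * a) ≠ 0 ∧ Real.sin (k * b) ≠ 0}

theorem measurableSet_bandSet : MeasurableSet (bandSet a b γ γ') := by
  have h := measurable_bandFun (a := a) (b := b) (γ := γ) (γ' := γ')
  refine (measurableSet_le h.abs measurable_const).inter (MeasurableSet.inter ?_ ?_)
  · exact (measurableSet_eq_fun (by fun_prop) measurable_const).compl
  · exact (measurableSet_eq_fun (by fun_prop) measurable_const).compl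

/-- For `γ' > γ` the bands correspond to carry 1, for `γ' < γ` to carry 0. Both have mean 1/2, so
the sign of `γ' - γ` does not affect the limit. -/
theorem tendsto_weightedMean_bandSet (ha : 0 < a) (hb : 0 < b) (hγ : γ' ≠ γ) :
    Filter.Tendsto (weightedMean ((bandSet a b γ γ').indicator 1)) Filter.atTop
      (nhds (1 / 2)) := by
  set g : ℝ → ℝ := if γ < γ' then carry a b else fun k => 1 - carry a b k with hg
  have hc01 : ∀ k, carry a b k ∈ Set.Icc (0 : ℝ) 1 := fun k => by
    rcases carry_cases a b k with ⟨h, -⟩ | ⟨h, -⟩ <;> rw [h] <;> norm_num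
  have hgm : Measurable g := by
    rw [hg]; split_ifs
    · exact measurable_carry
    · exact measurable_const.sub measurable_carry
  have hg01 : ∀ k, g k ∈ Set.Icc (0 : ℝ) 1 := by
    intro k
    have := hc01 k
    rw [hg]; split_ifs
    · exact this
    · exact ⟨by linarith [this.2], by linarith [this.1]⟩
  have hlim : Filter.Tendsto (weightedMean g) Filter.atTop (nhds (1 / 2)) := by
    have h := tendsto_weightedMean_carry ha hb
    rw [hg]; split_ifs
    · exact h
    · have h2 : Filter.Tendsto (fun R => 1 - weightedMean (carry a b) R) Filter.atTop
          (nhds (1 - 1 / 2)) := tendsto_const_nhds.sub h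
      rw [show (1 : ℝ) - 1 / 2 = 1 / 2 by norm_num] at h2
      refine h2.congr' ?_
      filter_upwards [Filter.eventually_gt_atTop 0] with R hR
      rw [weightedMean_sub (B := 1) (D := 1) measurable_const measurable_carry
        (fun _ => by norm_num) (fun k => by
          rw [abs_of_nonneg (hc01 k).1]; exact (hc01 k).2), weightedMean_const 1 hR.ne']
  refine tendsto_weightedMean_of_approx hb (add_pos ha hb)
    (measurable_one.indicator measurableSet_bandSet) hgm (fun k => ?_) hg01 ?_ hlim
  · by_cases h : k ∈ bandSet a b γ γ' <;> simp [h]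
  · intro δ hδ hδ1
    set C := (γ' - γ) ^ 2 / 8 + |γ| / 2 with hC
    have hC0 : 0 ≤ C := by positivity
    -- Beyond this threshold both `k ≥ 1` and `C / k < δ²/4` hold. Only `sin kb` and `sin k(a+b)`
    -- have to stay away from zero; for `sin ka`, being nonzero a.e. suffices.
    refine ⟨4 * C / δ ^ 2 + 1, by positivity, ?_⟩
    filter_upwards [ae_sin_ne_zero ha] with k hsa hk hsb hsab
    have hk1 : 1 ≤ k := by linarith [show 0 ≤ 4 * C / δ ^ 2 by positivity]
    have hkC : C / k < δ ^ 2 / 4 := by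
      rw [div_lt_iff₀ (by linarith)]
      have h1 : 4 * C / δ ^ 2 < k := by linarith
      rw [div_lt_iff₀ (by positivity)] at h1
      linarith
    have hiff := abs_bandFun_le_one_iff (b := b) hγ hδ hδ1 hk1 hkC hsa hsb hsab
    have hsb0 : Real.sin (k * b) ≠ 0 := abs_pos.1 (hδ.trans hsb)
    have hne : Real.sin (k * a) * Real.sin (k * b) * Real.sin (k * (a + b)) ≠ 0 :=
      mul_ne_zero (mul_ne_zero hsa hsb0) (abs_pos.1 (hδ.trans hsab))
    have hmem : k ∈ bandSet a b γ γ' ↔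
        (γ' - γ) * (Real.sin (k * a) * Real.sin (k * b) * Real.sin (k * (a + b))) < 0 := by
      rw [← hiff]
      exact ⟨fun h => h.1, fun h => ⟨h, hsa, hsb0⟩⟩
    rcases carry_cases a b k with ⟨hc, hs⟩ | ⟨hc, hs⟩
    · have hs' := lt_of_le_of_ne hs hne.symm
      rw [hg]
      split_ifs with hlt
      · have : k ∉ bandSet a b γ γ' := by
          rw [hmem, not_lt]; exact (mul_pos (sub_pos.2 hlt) hs').le
        rw [Set.indicator_of_notMem this, hc]
      · have : k ∈ bandSet a b γ γ' := by
          rw [hmem]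
          exact mul_neg_of_neg_of_pos (sub_neg.2 (lt_of_le_of_ne (not_lt.1 hlt) hγ)) hs'
        rw [Set.indicator_of_mem this]
        simp [hc]
    · have hs' := lt_of_le_of_ne hs hne
      rw [hg]
      split_ifs with hlt
      · have : k ∈ bandSet a b γ γ' := by
          rw [hmem]; exact mul_neg_of_pos_of_neg (sub_pos.2 hlt) hs'
        rw [Set.indicator_of_mem this, hc, Pi.one_apply]
      · have : k ∉ bandSet a b γ γ' := by
          rw [hmem, not_lt]
          exact (mul_pos_of_neg_of_neg (sub_neg.2 (lt_of_le_of_ne (not_lt.1 hlt) hγ)) hs').le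
        rw [Set.indicator_of_notMem this]
        simp [hc]

/-- Change of variables `E = k²`. The bands agree almost everywhere with the image of the measurable
set `bandSet`, so their own measurability is never needed. -/
theorem volume_inducedBands_inter (ha : 0 < a) (hb : 0 < b) (hγ : γ' ≠ γ) {R : ℝ} (hR : 0 < R) :
    (volume (inducedBands a b γ γ' ∩ Set.Icc 0 (R ^ 2))).toReal =
      ∫ k in (0 : ℝ)..R, 2 * k * (bandSet a b γ γ').indicator 1 k := by
  have hinj : Set.InjOn (fun k : ℝ => k ^ 2) (bandSet a b γ γ' ∩ Set.Ioc 0 R) := by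
    intro x hx y hy hxy
    exact (sq_eq_sq₀ hx.2.1.le hy.2.1.le).1 hxy
  have hmeas : MeasurableSet (bandSet a b γ γ' ∩ Set.Ioc 0 R) :=
    measurableSet_bandSet.inter measurableSet_Ioc
  have hae : (inducedBands a b γ γ' ∩ Set.Icc 0 (R ^ 2) : Set ℝ) =ᵐ[volume]
      ((fun k : ℝ => k ^ 2) '' (bandSet a b γ γ' ∩ Set.Ioc 0 R) : Set ℝ) := by
    -- The exceptional energies, where the description by `bandFun` breaks down, are among the
    -- countably many `(n π / c)²`.
    have hcount : ∀ c : ℝ, 0 < c → ∀ᵐ E : ℝ, 0 < E → Real.sin (√E * c) ≠ 0 := by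
      intro c hc
      have : {E : ℝ | ¬(0 < E → Real.sin (√E * c) ≠ 0)}.Countable := by
        refine (Set.countable_range fun n : ℤ => ((n : ℝ) * Real.pi / c) ^ 2).mono fun E hE => ?_
        simp only [Set.mem_ofPred_eq, Classical.not_imp, not_not] at hE
        obtain ⟨n, hn⟩ := Real.sin_eq_zero_iff.1 hE.2
        refine ⟨n, ?_⟩
        simp only
        rw [hn, mul_div_cancel_right₀ _ hc.ne', Real.sq_sqrt hE.1.le]
      exact this.measure_zero volume
    have h0 : ∀ᵐ E : ℝ, E ≠ 0 := by
      simpa using (Set.countable_singleton (0 : ℝ)).ae_notMem volume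
    filter_upwards [hcount a ha, hcount b hb, h0] with E h1 h2 h3
    refine propext ?_
    change (E ∈ inducedBands a b γ γ' ∧ E ∈ Set.Icc 0 (R ^ 2)) ↔
      E ∈ (fun k : ℝ => k ^ 2) '' (bandSet a b γ γ' ∩ Set.Ioc 0 R)
    constructor
    · rintro ⟨hE, hE0, hER⟩
      have hpos : 0 < E := lt_of_le_of_ne hE0 h3.symm
      have hsq : √E ^ 2 = E := Real.sq_sqrt hE0
      have hk : 0 < √E := Real.sqrt_pos.2 hpos
      refine ⟨√E, ⟨⟨?_, h1 hpos, h2 hpos⟩, hk, ?_⟩, hsq⟩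
      · rw [← mem_inducedBands_iff ha hb hγ hk (h1 hpos) (h2 hpos), hsq]
        exact hE
      · exact Real.sqrt_le_iff.2 ⟨hR.le, hER⟩
    · rintro ⟨k, ⟨⟨hk1, hk2, hk3⟩, hk4, hk5⟩, rfl⟩
      refine ⟨(mem_inducedBands_iff ha hb hγ hk4 hk2 hk3).2 hk1, by positivity, ?_⟩
      exact pow_le_pow_left₀ hk4.le hk5 2
  rw [measure_congr hae]
  have hcv := integral_image_eq_integral_abs_deriv_smul (f' := fun k => 2 * k) hmeas
    (fun x _ => by simpa using (hasDerivAt_pow 2 x).hasDerivWithinAt) hinj (fun _ => (1 : ℝ))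
  rw [setIntegral_const, smul_eq_mul, mul_one] at hcv
  change volume.real _ = _
  rw [hcv, intervalIntegral.integral_of_le hR.le, Set.inter_comm, ← setIntegral_indicator
    measurableSet_bandSet]
  refine setIntegral_congr_fun measurableSet_Ioc fun k hk => ?_
  by_cases h : k ∈ bandSet a b γ γ'
  · simp [h, abs_of_pos hk.1]
  · simp [h]

end

end CombGraph

end

theorem proposition4p1 (a b γ γ' : ℝ) (ha : 0 < a) (hb : 0 < b) (hγ : γ' ≠ γ) :
    Filter.Tendsto
      (fun K : ℝ =>
        (MeasureTheory.volume (CombGraph.inducedBands a b γ γ' ∩ Set.Icc 0 K)).toReal / K)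
      Filter.atTop (nhds (1 / 2)) := by
  refine ((CombGraph.tendsto_weightedMean_bandSet ha hb hγ).comp Real.tendsto_sqrt_atTop).congr' ?_
  filter_upwards [Filter.eventually_gt_atTop 0] with K hK
  have h := CombGraph.volume_inducedBands_inter ha hb hγ (Real.sqrt_pos.2 hK)
  rw [Real.sq_sqrt hK.le] at h
  rw [h, Function.comp, CombGraph.weightedMean, Real.sq_sqrt hK.le]
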